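/- **Setting.** An offline AdCell instance has $m$ advertisers with budgets $B_i>0$, $n$ queries, $s$ customers, and bids $b_{i,j}\ge 0$. Each query $j$ belongs to one customer; $S_k$ is the set of queries of customer $k$, and $c_k\in\mathbb{N}$ is the capacity of $k$. It is known which queries arrive: $I_j\in\{0,1\}$. An allocation $X\in\{0,1\}^{m\times n}$ is *feasible* if it satisfies the assignment constraints $\sum_i X_{ij}\le I_j$ for all $j$ and the capacity constraints $\sum_{j\in S_k}\sum_i X_{ij}\le c_k$ for all $k$. Its revenue is $\sum_i\min\bigl(\sum_j X_{ij}b_{i,j},B_i\bigr)$. The LP relaxation maximizes $\sum_{i,j}x_{ij}b_{i,j}$ over $x\in[0,1]^{m\times n}$ subject to the assignment constraints, the capacity constraints and the budget constraints $\sum_j x_{ij}b_{i,j}\le B_i$ for all $i$; $\mathsf{LPOpt}$ is its optimal value. Put $\rho=\max_i b_{i,\max}/B_i$ with $b_{i,\max}=\max_j b_{i,j}$. **Iterative rounding.** Start from an optimal LP solution $y$. In the current $y$, call the variable of the edge $(i,j)$ *fractional* if $0<y_{ij}<1$; the other variables are rounded and stay fixed. The *kept constraints* at $y$ are $x\in[0,1]^{m\times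 n}$, all assignment and capacity constraints, and the budget constraints of the advertisers with at least two fractional edges at $y$. A *direction* is a nonzero $r$ supported on the fractional edges; a *maximal step* along $r$ is the largest $\alpha>0$ for which $y+\alpha r$ satisfies the kept constraints. While some variable is fractional, make one of the following moves. * *Cycle breaking* (only if the bipartite graph of fractional edges is not a forest): replace $y$ by $y+\beta z$, a maximal step along a direction $z$ that changes the payment $\sum_j y_{ij}b_{i,j}$ of no advertiser and the total $\sum_i y_{ij}$ of at most one query, which does not increase. * *Rand-Move* (only if that graph is a forest): for a direction $r$ with maximal steps $\alpha>0$ along $r$ and $\beta>0$ along $-r$, replace $y$ by $y+\alpha r$ with probability $\frac{\beta}{\alpha+\beta}$ and by $y-\beta r$ with probability $\frac{\alpha}{\alpha+\beta}$. * *Lowering a tight customer* (only if that graph is a forest): replace $y$ by $y+\beta z$, a maximal step along a direction $z$ that changes the payment of no advertiser, the total of no query with tight assignment constraint, and the load $\sum_{j\in S_k}\sum_i y_{ij}$ of at most one customer, whose capacity constraint is tight and whose load does not increase. The choice among the possible moves is arbitrary and may depend on the past. **Theorem.** There is an absolute constant $C$ such that the following holds for all $m,n,s$ and all instances. 1. From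 any optimal LP solution, every execution makes at most $C(m+n+s+1)^C$ moves, and a move is available as long as some variable is fractional. The final allocation always satisfies all assignment and capacity constraints, and its expected revenue is at least $$\frac{4-\rho}{4}\,\mathsf{LPOpt}.$$ In particular it is at least $\frac34\mathsf{LPOpt}$ if $b_{i,j}\le B_i$ for all $i,j$, and at least $\frac{4-\epsilon}{4}\mathsf{LPOpt}$ if $b_{i,j}\le\epsilon B_i$ for all $i,j$. 2. $\mathsf{LPOpt}$ is at least the revenue of every feasible allocation. Without any assumption on the bids, run the rounding on the instance with bids $\min(b_{i,j},B_i)$: the resulting allocation is feasible, and its expected revenue (for the original bids) is at least $\frac34$ of the LP optimum of the truncated instance and at least $\frac34$ of the maximum revenue of a feasible allocation of the original instance. 3. The rounding takes polynomial time, given an optimal LP solution: for all $m,n,s$ there is a randomized algebraic computation tree (arithmetic operations and comparisons of real numbers and tosses of coins with a computed bias, each at unit cost) of depth at most $C(m+n+s+1)^C$ which, on input any instance and any optimal solution of its LP, outputs an allocation distributed as in some execution of the rounding. -/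

import Mathlib

noncomputable section

/-- An offline instance: `m` advertisers, `n` queries, `s` customers. Query `j` belongs to
customer `customer j`, and `arrives` is the (known) set of queries that arrive. -/
structure AdCell (m n s : ℕ) where
  budget : Fin m → ℝ
  bid : Fin m → Fin n → ℝ
  customer : Fin n → Fin s
  capacity : Fin s → ℕ
  arrives : Finset (Fin n)
  budget_pos : ∀ i, 0 < budget i
  bid_nonneg : ∀ i j, 0 ≤ bid i j

/-- A fractional solution. -/
abbrev Frac (m n : ℕ) : Type := Fin m → Fin n → ℝ

/-- An integral allocation: `X i j` says that the ad of advertiser `i` is shown on query `j`. -/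
abbrev Alloc (m n : ℕ) : Type := Fin m → Fin n → Bool

/-- The 0/1 vector of an integral allocation. -/
def Alloc.toFrac {m n : ℕ} (X : Alloc m n) : Frac m n := fun i j => if X i j then 1 else 0

/-- The expectation of a real function under a probability mass function on a finite type. -/
def PMF.expect {α : Type*} [Fintype α] (D : PMF α) (f : α → ℝ) : ℝ :=
  ∑ a, (D a).toReal * f a

/-- A coin that shows `true` with probability `p`, for `p ∈ [0,1]` (other `p` are clamped). -/
def realCoin (p : ℝ) : PMF Bool :=
  PMF.ofFintype
    (fun b => cond b (min (ENNReal.ofReal p) 1) (1 - min (ENNReal.ofReal p) 1))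
    (by simp)

/-- The law `D₁` with probability `p` and the law `D₂` with probability `1 - p`. -/
def PMF.mix {α : Type*} (p : ℝ) (D₁ D₂ : PMF α) : PMF α :=
  (realCoin p).bind fun h => if h then D₁ else D₂

namespace AdCell

variable {m n s : ℕ} (I : AdCell m n s)

/-! ### The integer program and its linear relaxation -/

/-- The indicator that query `j` arrives. -/
def arrival (j : Fin n) : ℝ := if j ∈ I.arrives then 1 else 0

/-- The total (fractional) assignment of query `j`. -/
def queryLoad (x : Frac m n) (j : Fin n) : ℝ := ∑ i, x i j

/-- The total (fractional) number of ads sent to customer `k`. -/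
def customerLoad (x : Frac m n) (k : Fin s) : ℝ :=
  ∑ j with I.customer j = k, queryLoad x j

/-- The sum of the bids of advertiser `i` on what is assigned to it, without the budget cap. -/
def payment (x : Frac m n) (i : Fin m) : ℝ := ∑ j, x i j * I.bid i j

/-- The assignment constraints. -/
def Assign (x : Frac m n) : Prop := ∀ j, queryLoad x j ≤ I.arrival j

/-- The capacity constraints. -/
def Capacity (x : Frac m n) : Prop := ∀ k, I.customerLoad x k ≤ I.capacity k

/-- All entries lie in `[0,1]`. -/
def Box (x : Frac m n) : Prop := ∀ i j, 0 ≤ x i j ∧ x i j ≤ 1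

/-- Feasible solutions of the linear program. -/
def LPFeasible (x : Frac m n) : Prop :=
  Box x ∧ I.Assign x ∧ I.Capacity x ∧ ∀ i, I.payment x i ≤ I.budget i

/-- The objective of the linear program. -/
def lpValue (x : Frac m n) : ℝ := ∑ i, I.payment x i

/-- The optimal value of the linear program. -/
def lpOpt : ℝ := sSup (I.lpValue '' {x | I.LPFeasible x})

/-- Optimal solutions of the linear program. -/
def IsLPOptimal (y : Frac m n) : Prop :=
  I.LPFeasible y ∧ ∀ x, I.LPFeasible x → I.lpValue x ≤ I.lpValue y

/-- Feasible allocations of the integer program: assignment and capacity constraints. -/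
def Feasible (X : Alloc m n) : Prop := I.Assign X.toFrac ∧ I.Capacity X.toFrac

/-- The revenue of an allocation: every advertiser pays at most its budget. -/
def revenue (X : Alloc m n) : ℝ := ∑ i, min (I.payment X.toFrac i) (I.budget i)

/-- `max_i max_j (bid i j / budget i)`. -/
def maxBidRatio : ℝ := ⨆ i, ⨆ j, I.bid i j / I.budget i

/-- The same instance with every bid cut down to the budget of its advertiser. -/
def truncate : AdCell m n s where
  budget := I.budget
  bid i j := min (I.bid i j) (I.budget i)
  customer := I.customer
  capacity := I.capacity
  arrives := I.arrives
  budget_pos := I.budget_pos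
  bid_nonneg i j := le_min (I.bid_nonneg i j) (I.budget_pos i).le

/-! ### The iterative rounding -/

/-- The edge `(i, j)` is fractional: its variable is not rounded yet. -/
def IsFrac (y : Frac m n) (i : Fin m) (j : Fin n) : Prop := 0 < y i j ∧ y i j < 1

/-- All variables are rounded. -/
def Rounded (y : Frac m n) : Prop := ∀ i j, y i j = 0 ∨ y i j = 1

/-- The bipartite graph of the fractional edges between advertisers and queries. -/
def fracGraph (y : Frac m n) : SimpleGraph (Fin m ⊕ Fin n) :=
  SimpleGraph.fromRel fun a b => ∃ i j, a = Sum.inl i ∧ b = Sum.inr j ∧ IsFrac y i j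

/-- The degree of advertiser `i` in the graph of the fractional edges. -/
def advDegree (y : Frac m n) (i : Fin m) : ℕ := Set.ncard {j | IsFrac y i j}

/-- The system of constraints that an update of `y` has to respect: everything in the linear
program except the budgets of the advertisers with at most one fractional edge. -/
def Keeps (y x : Frac m n) : Prop :=
  Box x ∧ I.Assign x ∧ I.Capacity x ∧
    ∀ i, 2 ≤ advDegree y i → I.payment x i ≤ I.budget i

/-- A nonzero direction that changes fractional variables only. -/
def IsDirection (y r : Frac m n) : Prop := r ≠ 0 ∧ ∀ i j, r i j ≠ 0 → IsFrac y i j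

/-- From `y` one can go the distance `α > 0` along `r`, and no further, within the system of
constraints: at `y + α r` a variable gets rounded or a constraint becomes tight. -/
def MaxStep (y r : Frac m n) (α : ℝ) : Prop :=
  0 < α ∧ I.Keeps y (y + α • r) ∧ ∀ α', α < α' → ¬ I.Keeps y (y + α' • r)

/-- One iteration of the rounding, from `y` to a random solution with the given law. -/
inductive Move (y : Frac m n) : PMF (Frac m n) → Prop
  /-- As long as the fractional edges do not form a forest: a deterministic update that keeps
  the payments of all advertisers and all query loads but one, which does not grow. -/
  | breakCycle (z : Frac m n) (β : ℝ) (j₀ : Fin n) :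
      ¬ (fracGraph y).IsAcyclic → IsDirection y z → (∀ i, I.payment z i = 0) →
      (∀ j, j ≠ j₀ → queryLoad z j = 0) → queryLoad z j₀ ≤ 0 → I.MaxStep y z β →
      Move y (PMF.pure (y + β • z))
  /-- Rand-Move on a forest: `y + α r` with probability `β / (α + β)`, otherwise `y - β r`. -/
  | randMove (r : Frac m n) (α β : ℝ) :
      (fracGraph y).IsAcyclic → IsDirection y r → I.MaxStep y r α → I.MaxStep y (-r) β →
      Move y (PMF.mix (β / (α + β)) (PMF.pure (y + α • r)) (PMF.pure (y - β • r)))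
  /-- On a forest, along a (combined) path between two queries of one customer `k₀` whose
  capacity is tight: a deterministic update that keeps the payments of all advertisers, the loads
  of the queries with tight assignment constraint, and the loads of all customers but `k₀`, whose
  load does not grow. -/
  | lowerTight (z : Frac m n) (β : ℝ) (k₀ : Fin s) :
      (fracGraph y).IsAcyclic → IsDirection y z → (∀ i, I.payment z i = 0) →
      (∀ j, queryLoad y j = I.arrival j → queryLoad z j = 0) →
      I.customerLoad y k₀ = I.capacity k₀ →
      (∀ k, k ≠ k₀ → I.customerLoad z k = 0) → I.customerLoad z k₀ ≤ 0 → I.MaxStep y z β →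
      Move y (PMF.pure (y + β • z))

/-- `y'` is a possible outcome of one iteration from `y`. -/
def Step (y y' : Frac m n) : Prop := ∃ μ, I.Move y μ ∧ y' ∈ μ.support

/-- `D` is the law of the allocation found by the iterative rounding started at `y`, for some way
of choosing, depending on all that happened so far, the next move. -/
inductive Rounds : Frac m n → PMF (Alloc m n) → Prop
  | done (X : Alloc m n) : Rounds X.toFrac (PMF.pure X)
  | move (y : Frac m n) (μ : PMF (Frac m n)) (K : Frac m n → PMF (Alloc m n)) :
      I.Move y μ → (∀ y' ∈ μ.support, Rounds y' (K y')) → Rounds y (μ.bind K)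

end AdCell

/-! ### The machine model: randomized algebraic computation trees -/

/-- The four arithmetic operations. -/
inductive ArithOp
  | add | sub | mul | div

/-- The value of an arithmetic operation. -/
def ArithOp.eval : ArithOp → ℝ → ℝ → ℝ
  | add, a, b => a + b
  | sub, a, b => a - b
  | mul, a, b => a * b
  | div, a, b => a / b

/-- A randomized algebraic computation tree with input registers `R`, work registers `ℕ` and
outputs in `Out`. -/
inductive CompTree (R Out : Type) : Type
  | output (o : Out) : CompTree R Out
  /-- Put the constant `1` into work register `t`. -/
  | one (t : ℕ) (next : CompTree R Out) : CompTree R Out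
  /-- Put the value of an operation on two registers into work register `t`. -/
  | arith (t : ℕ) (op : ArithOp) (a b : R ⊕ ℕ) (next : CompTree R Out) : CompTree R Out
  /-- Compare two registers. -/
  | branch (a b : R ⊕ ℕ) (le gt : CompTree R Out) : CompTree R Out
  /-- Toss a coin whose bias is the content of a register. -/
  | coin (a : R ⊕ ℕ) (heads tails : CompTree R Out) : CompTree R Out

namespace CompTree

variable {R Out : Type}

/-- The running time: the largest number of instructions on a branch. -/
def time : CompTree R Out → ℕ
  | output _ => 0
  | one _ next => next.time + 1
  | arith _ _ _ _ next => next.time + 1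
  | branch _ _ le gt => max le.time gt.time + 1
  | coin _ heads tails => max heads.time tails.time + 1

/-- The law of the output, from given contents `ρ` of the input registers and `w` of the work
registers. -/
def runFrom (ρ : R → ℝ) : CompTree R Out → (ℕ → ℝ) → PMF Out
  | output o, _ => PMF.pure o
  | one t next, w => next.runFrom ρ (Function.update w t 1)
  | arith t op a b next, w =>
      next.runFrom ρ (Function.update w t (op.eval (Sum.elim ρ w a) (Sum.elim ρ w b)))
  | branch a b le gt, w =>
      if Sum.elim ρ w a ≤ Sum.elim ρ w b then le.runFrom ρ w else gt.runFrom ρ w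
  | coin a heads tails, w =>
      PMF.mix (Sum.elim ρ w a) (heads.runFrom ρ w) (tails.runFrom ρ w)

/-- The law of the output on a given input, with all work registers `0` at the start. -/
def run (T : CompTree R Out) (input : R → ℝ) : PMF Out := T.runFrom input fun _ => 0

end CompTree

/-- The names of the numbers that describe an instance together with a fractional solution. -/
inductive InputReg (m n s : ℕ) : Type
  | budget (i : Fin m)
  | bid (i : Fin m) (j : Fin n)
  | customer (j : Fin n) (k : Fin s)
  | capacity (k : Fin s)
  | arrival (j : Fin n)
  | sol (i : Fin m) (j : Fin n)

/-- The numbers that describe an instance together with a fractional solution. -/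
def AdCell.input {m n s : ℕ} (I : AdCell m n s) (y : Frac m n) : InputReg m n s → ℝ
  | .budget i => I.budget i
  | .bid i j => I.bid i j
  | .customer j k => if I.customer j = k then 1 else 0
  | .capacity k => I.capacity k
  | .arrival j => I.arrival j
  | .sol i j => y i j

end

/-! Revenue. Fix an advertiser. Deterministic moves preserve its payment and a randomized move
preserves it in expectation. As long as it has two fractional edges its budget is a kept constraint,
so when at most one fractional edge is left its payment is still at most the budget `B`. Let `a` be
its payment on the rounded edges, `b` the bid on the last edge and `p` the value of that edge, so `a
+ p * b ≤ B`. The expected capped payment is at least the affine interpolation in `p` between its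
values at `0` and `1`. The cap therefore costs at most `p * (a + b - B)` if `a + b > B` and nothing
otherwise, and this is at most `b / (4 * B)` times the payment, essentially because `p * (1 - p) ≤
1/4`. Summing over the advertisers gives the ratio (`one_sub_mul_le_of_last_edge`,
`Rounds.expect_advertiser`). Truncating bids at the budgets does not change the revenue of any
integral allocation, so the case of large bids reduces to `ε = 1`.

Termination. Every move decreases, lexicographically, the number of fractional edges, the number of
loose queries and the number of loose kept rows (`Step.potential_lt`).

Availability. A move comes from a nonzero solution of a homogeneous system with fewer equations than
unknowns. A cycle has as many vertices as edges, and one query equation may be dropped. In a forest,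
double counting in the graph where loose queries are merged into their customers leaves too few
equations, or equality holds everywhere and a tight customer can be freed, or a leaf contradicts
integrality (`Pattern.exists_plan_of_acyclic`, `exists_plan`).

Polynomial time. The tree is not written down; `Solvable` asserts that one tree serves a whole set
of inputs. Polynomially many comparisons split this set until the combinatorial pattern is constant.
A plan is then chosen once for the branch, Gaussian elimination and ratio tests turn it into a move,
and the potential bounds the recursion (`Solvable.kernel`, `Solvable.ratioTest`, `Continues.succ`).
-/

namespace AdCell

variable {m n s : ℕ} (I : AdCell m n s)

/-! ### The linear constraints of the program in a uniform notation -/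

/-- The names of the linear constraints: budgets, assignments and capacities. -/
abbrev Row (m n s : ℕ) : Type := Fin m ⊕ Fin n ⊕ Fin s

/-- The left-hand side of a linear constraint. -/
def load (x : Frac m n) : Row m n s → ℝ
  | .inl i => I.payment x i
  | .inr (.inl j) => queryLoad x j
  | .inr (.inr k) => I.customerLoad x k

/-- The right-hand side of a linear constraint. -/
def bound : Row m n s → ℝ
  | .inl i => I.budget i
  | .inr (.inl j) => I.arrival j
  | .inr (.inr k) => I.capacity k

/-- The coefficient of an edge in a linear constraint. -/
def coef : Row m n s → Fin m × Fin n → ℝ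
  | .inl i, e => if e.1 = i then I.bid e.1 e.2 else 0
  | .inr (.inl j), e => if e.2 = j then 1 else 0
  | .inr (.inr k), e => if I.customer e.2 = k then 1 else 0

theorem load_eq_sum (x : Frac m n) (v : Row m n s) :
    I.load x v = ∑ e : Fin m × Fin n, I.coef v e * x e.1 e.2 := by
  rcases v with i | j | k
  · simp only [load, coef, payment, Fintype.sum_prod_type, ite_mul, zero_mul]
    rw [Finset.sum_comm]
    simp [mul_comm]
  · simp [load, coef, queryLoad, Fintype.sum_prod_type]
  · simp only [load, coef, customerLoad, queryLoad, Fintype.sum_prod_type_right, ite_mul, zero_mul,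
      one_mul, Finset.sum_filter]
    refine Finset.sum_congr rfl fun j _ => ?_
    split_ifs <;> simp

theorem load_add_smul (y r : Frac m n) (α : ℝ) (v : Row m n s) :
    I.load (y + α • r) v = I.load y v + α * I.load r v := by
  simp only [load_eq_sum, Finset.mul_sum, ← Finset.sum_add_distrib]
  refine Finset.sum_congr rfl fun e _ => ?_
  simp only [Pi.add_apply, Pi.smul_apply, smul_eq_mul]
  ring

theorem load_neg (r : Frac m n) (v : Row m n s) : I.load (-r) v = -I.load r v := by
  simp [load_eq_sum]

/-- The linear constraints that an update of `y` has to respect. -/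
def Active (y : Frac m n) : Row m n s → Prop
  | .inl i => 2 ≤ advDegree y i
  | .inr _ => True

theorem keeps_iff (y x : Frac m n) :
    I.Keeps y x ↔ Box x ∧ ∀ v, Active y v → I.load x v ≤ I.bound v := by
  simp only [Keeps, Sum.forall, Active, load, bound, Assign, Capacity]
  tauto

/-- All constraints, with the bounds `0` and `1` on the variables. -/
abbrev Ineq (m n s : ℕ) : Type := (Fin m × Fin n) ⊕ (Fin m × Fin n) ⊕ Row m n s

/-- The rate at which the direction `r` uses up a constraint. -/
def slope (r : Frac m n) : Ineq m n s → ℝ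
  | .inl e => -r e.1 e.2
  | .inr (.inl e) => r e.1 e.2
  | .inr (.inr v) => I.load r v

/-- The slack of a constraint at `y`. -/
def slack (y : Frac m n) : Ineq m n s → ℝ
  | .inl e => y e.1 e.2
  | .inr (.inl e) => 1 - y e.1 e.2
  | .inr (.inr v) => I.bound v - I.load y v

/-- The constraints that an update of `y` has to respect. -/
def ActiveIneq (y : Frac m n) : Ineq m n s → Prop
  | .inr (.inr v) => Active y v
  | _ => True

/-- All constraints are affine, so along a ray they become scalar inequalities in the step length.
The bounds of the box are treated on the same footing as the rows, which makes a maximal step a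
plain ratio test. -/
theorem keeps_add_smul_iff (y y₀ r : Frac m n) (α : ℝ) :
    I.Keeps y₀ (y + α • r) ↔ ∀ c, ActiveIneq y₀ c → α * I.slope r c ≤ I.slack y c := by
  rw [keeps_iff]
  simp only [Box, load_add_smul]
  constructor
  · rintro ⟨h1, h2⟩ c hc
    rcases c with e | e | v
    · have := (h1 e.1 e.2).1
      simp only [slope, slack, Pi.add_apply, Pi.smul_apply, smul_eq_mul] at *
      linarith
    · have := (h1 e.1 e.2).2
      simp only [slope, slack, Pi.add_apply, Pi.smul_apply, smul_eq_mul] at *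
      linarith
    · have := h2 v hc
      simp only [slope, slack] at *
      linarith
  · intro h
    refine ⟨fun i j => ⟨?_, ?_⟩, fun v hv => ?_⟩
    · have := h (.inl (i, j)) trivial
      simp only [slope, slack, Pi.add_apply, Pi.smul_apply, smul_eq_mul] at *
      linarith
    · have := h (.inr (.inl (i, j))) trivial
      simp only [slope, slack, Pi.add_apply, Pi.smul_apply, smul_eq_mul] at *
      linarith
    · have := h (.inr (.inr v)) hv
      simp only [slope, slack] at *
      linarith

theorem slack_nonneg {y : Frac m n} (h : I.Keeps y y) (c : Ineq m n s) (hc : ActiveIneq y c) :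
    0 ≤ I.slack y c := by
  have := (I.keeps_add_smul_iff y y 0 0).1 (by simpa using h) c hc
  simpa using this

/-- The ratio test computes the maximal step. -/
theorem maxStep_of_ratio {y r : Frac m n} {α : ℝ} (c₀ : Ineq m n s) (hy : I.Keeps y y)
    (hpos : ∀ c, ActiveIneq y c → 0 < I.slope r c → 0 < I.slack y c)
    (hc₀ : ActiveIneq y c₀) (hs : 0 < I.slope r c₀) (hα : α = I.slack y c₀ / I.slope r c₀)
    (hmin : ∀ c, ActiveIneq y c → 0 < I.slope r c → α ≤ I.slack y c / I.slope r c) :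
    I.MaxStep y r α := by
  have hα0 : 0 < α := hα ▸ div_pos (hpos c₀ hc₀ hs) hs
  refine ⟨hα0, ?_, fun α' h' hk => ?_⟩
  · rw [keeps_add_smul_iff]
    intro c hc
    rcases lt_or_ge 0 (I.slope r c) with h | h
    · exact (le_div_iff₀ h).1 (hmin c hc h)
    · exact (mul_nonpos_of_nonneg_of_nonpos hα0.le h).trans (I.slack_nonneg hy c hc)
  · rw [keeps_add_smul_iff] at hk
    have := (le_div_iff₀ hs).2 (hk c₀ hc₀)
    linarith

/-- A maximal step ends at a constraint that becomes tight. -/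
theorem MaxStep.exists_tight {I : AdCell m n s} {y r : Frac m n} {α : ℝ} (h : I.MaxStep y r α) :
    ∃ c, ActiveIneq y c ∧ 0 < I.slope r c ∧ α * I.slope r c = I.slack y c := by
  obtain ⟨h0, hk, hmax⟩ := h
  rw [keeps_add_smul_iff] at hk
  by_contra! hcon
  -- If no constraint with positive slope were tight at `α`, each of the finitely many constraints
  -- would survive slightly beyond `α`, against maximality.
  have hev : ∀ᶠ a in nhdsWithin α (Set.Ioi α),
      ∀ c, ActiveIneq y c → a * I.slope r c ≤ I.slack y c := by
    rw [Filter.eventually_all]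
    intro c
    by_cases hc : ActiveIneq y c
    · rcases lt_or_ge 0 (I.slope r c) with hs | hs
      · have hlt : α * I.slope r c < I.slack y c := lt_of_le_of_ne (hk c hc) (hcon c hc hs)
        have : Filter.Tendsto (fun a => a * I.slope r c) (nhdsWithin α (Set.Ioi α))
            (nhds (α * I.slope r c)) :=
          ((continuous_id.mul continuous_const).tendsto α).mono_left nhdsWithin_le_nhds
        filter_upwards [this.eventually (gt_mem_nhds hlt)] with a ha _ using ha.le
      · filter_upwards [self_mem_nhdsWithin] with a ha _
        have : α < a := ha
        have := hk c hc
        nlinarith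
    · exact Filter.Eventually.of_forall fun a h => absurd h hc
  obtain ⟨a, ha, ha'⟩ := (hev.and self_mem_nhdsWithin).exists
  exact hmax a ha' ((I.keeps_add_smul_iff y y r a).2 ha)

/-! ### Invariants of the rounding -/

theorem eq_of_not_isFrac {y : Frac m n} (hy : Box y) {i : Fin m} {j : Fin n}
    (h : ¬ IsFrac y i j) : y i j = 0 ∨ y i j = 1 := by
  have := hy i j
  by_contra! hne
  exact h ⟨lt_of_le_of_ne this.1 hne.1.symm, lt_of_le_of_ne this.2 hne.2⟩

theorem isFrac_of_add_smul {y r : Frac m n} {α : ℝ} (hr : IsDirection y r) {i : Fin m} {j : Fin n}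
    (h : IsFrac (y + α • r) i j) : IsFrac y i j := by
  by_cases h0 : r i j = 0
  · simpa [IsFrac, h0] using h
  · exact hr.2 i j h0

theorem advDegree_mono {y y' : Frac m n} {i : Fin m}
    (h : ∀ j, IsFrac y' i j → IsFrac y i j) : advDegree y' i ≤ advDegree y i :=
  Set.ncard_le_ncard (fun _ hj => h _ hj) (Set.toFinite _)

theorem Active.mono {y y' : Frac m n} (h : ∀ i j, IsFrac y' i j → IsFrac y i j) {v : Row m n s}
    (hv : Active y' v) : Active y v := by
  rcases v with i | v
  · exact le_trans (show 2 ≤ advDegree y' i from hv) (advDegree_mono (h i))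
  · trivial

/-- Losing fractional edges can only drop budgets from the kept system. A budget once dropped never
has to be respected again. -/
theorem Keeps.mono {I : AdCell m n s} {y y' x : Frac m n}
    (h : ∀ i j, IsFrac y' i j → IsFrac y i j) (hk : I.Keeps y x) : I.Keeps y' x := by
  rw [keeps_iff] at *
  exact ⟨hk.1, fun v hv => hk.2 v (hv.mono h)⟩

theorem IsDirection.neg {y r : Frac m n} (h : IsDirection y r) : IsDirection y (-r) :=
  ⟨neg_ne_zero.2 h.1, fun i j hij => h.2 i j (by simpa using hij)⟩

/-- What all outcomes of a move have in common. -/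
theorem Step.exists_maxStep {I : AdCell m n s} {y y' : Frac m n} (h : I.Step y y') :
    ∃ r α, IsDirection y r ∧ I.MaxStep y r α ∧ y' = y + α • r := by
  obtain ⟨μ, hμ, hy'⟩ := h
  cases hμ with
  | breakCycle z β j₀ _ hz _ _ _ hβ =>
    exact ⟨z, β, hz, hβ, by simpa using hy'⟩
  | randMove r α β _ hr hα hβ =>
    simp only [PMF.mix, PMF.mem_support_bind_iff] at hy'
    obtain ⟨b, -, hb⟩ := hy'
    cases b
    · exact ⟨-r, β, hr.neg, hβ, by simpa [sub_eq_add_neg] using hb⟩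
    · exact ⟨r, α, hr, hα, by simpa using hb⟩
  | lowerTight z β k₀ _ hz _ _ _ _ _ hβ =>
    exact ⟨z, β, hz, hβ, by simpa using hy'⟩

theorem Step.isFrac {I : AdCell m n s} {y y' : Frac m n} (h : I.Step y y') {i : Fin m} {j : Fin n}
    (hf : IsFrac y' i j) : IsFrac y i j := by
  obtain ⟨r, α, hr, -, rfl⟩ := h.exists_maxStep
  exact isFrac_of_add_smul hr hf

theorem Step.keeps {I : AdCell m n s} {y y' : Frac m n} (h : I.Step y y') : I.Keeps y y' := by
  obtain ⟨r, α, hr, hα, rfl⟩ := h.exists_maxStep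
  exact hα.2.1

/-- The outcome is only known to satisfy the system of the old point. Its own system is weaker,
which makes this an invariant. -/
theorem Step.keeps_self {I : AdCell m n s} {y y' : Frac m n} (h : I.Step y y') : I.Keeps y' y' :=
  h.keeps.mono fun _ _ hf => h.isFrac hf

theorem LPFeasible.keeps {I : AdCell m n s} {y : Frac m n} (h : I.LPFeasible y) : I.Keeps y y :=
  ⟨h.1, h.2.1, h.2.2.1, fun i _ => h.2.2.2 i⟩

/-! ### Progress -/

open Classical in
/-- The fractional edges. -/
noncomputable def fracEdges (y : Frac m n) : Finset (Fin m × Fin n) := {e | IsFrac y e.1 e.2}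

open Classical in
/-- The queries whose assignment constraint is not tight. -/
noncomputable def looseQueries (y : Frac m n) : Finset (Fin n) := {j | queryLoad y j ≠ I.arrival j}

open Classical in
/-- The kept constraints that are not tight. -/
noncomputable def looseRows (y : Frac m n) : Finset (Row m n s) :=
  {v | Active y v ∧ I.load y v ≠ I.bound v}

/-- A potential that decreases in every move. -/
noncomputable def potential (y : Frac m n) : ℕ :=
  -- Three digits in mixed radix encode the lexicographic order: there are at most `n` loose queries
  -- and at most `m + n + s` loose rows.
  (fracEdges y).card * ((n + 1) * (m + n + s + 1)) +
    ((I.looseQueries y).card * (m + n + s + 1) + (I.looseRows y).card)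

theorem card_looseRows_lt (y : Frac m n) : (I.looseRows y).card < m + n + s + 1 := by
  have := Finset.card_le_univ (I.looseRows y)
  simp only [Fintype.card_sum, Fintype.card_fin] at this
  omega

theorem potential_tail_lt (y : Frac m n) :
    (I.looseQueries y).card * (m + n + s + 1) + (I.looseRows y).card <
      (n + 1) * (m + n + s + 1) := by
  have h1 := I.card_looseRows_lt y
  have h2 : (I.looseQueries y).card ≤ n := by simpa using Finset.card_le_univ (I.looseQueries y)
  have := Nat.mul_le_mul_right (m + n + s + 1) h2
  rw [Nat.succ_mul]
  omega

theorem potential_lt (y : Frac m n) :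
    I.potential y < (m * n + 1) * ((n + 1) * (m + n + s + 1)) := by
  have h1 := I.potential_tail_lt y
  have h2 : (fracEdges y).card ≤ m * n := by simpa using Finset.card_le_univ (fracEdges y)
  have := Nat.mul_le_mul_right ((n + 1) * (m + n + s + 1)) h2
  rw [Nat.succ_mul]
  unfold potential
  omega

theorem add_lt_add_of_lex {a a' b b' w : ℕ} (hb : b' < w) (h : a' < a ∨ a' = a ∧ b' < b) :
    a' * w + b' < a * w + b := by
  rcases h with h | ⟨rfl, h⟩
  · have := Nat.mul_le_mul_right w (Nat.succ_le_of_lt h)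
    rw [Nat.succ_mul] at this
    omega
  · omega

/-- The number of fractional edges is the leading digit and never grows, so the lower digits matter
only when no variable gets rounded. -/
theorem potential_lt_of_loose {y y' : Frac m n} (hf : ∀ i j, IsFrac y' i j → IsFrac y i j)
    (h : fracEdges y' = fracEdges y → I.looseQueries y' ⊂ I.looseQueries y ∨
      I.looseQueries y' ⊆ I.looseQueries y ∧ I.looseRows y' ⊂ I.looseRows y) :
    I.potential y' < I.potential y := by
  have hsub : fracEdges y' ⊆ fracEdges y := by
    intro e he
    simp only [fracEdges, Finset.mem_filter, Finset.mem_univ, true_and] at *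
    exact hf _ _ he
  refine add_lt_add_of_lex (I.potential_tail_lt y') ?_
  by_cases he : fracEdges y' = fracEdges y
  · refine .inr ⟨by rw [he], add_lt_add_of_lex (I.card_looseRows_lt y') ?_⟩
    rcases h he with h | ⟨h1, h2⟩
    · exact .inl (Finset.card_lt_card h)
    · rcases (Finset.card_le_card h1).lt_or_eq with h | h
      · exact .inl h
      · exact .inr ⟨h, Finset.card_lt_card h2⟩
  · exact .inl (Finset.card_lt_card (hsub.ssubset_of_ne he))

/-- If a maximal step rounds no variable, then a linear constraint becomes tight. -/
theorem MaxStep.exists_row {I : AdCell m n s} {y r : Frac m n} {α : ℝ} (h : I.MaxStep y r α)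
    (hr : IsDirection y r) (hE : fracEdges (y + α • r) = fracEdges y) :
    ∃ v, Active y v ∧ 0 < I.load r v ∧ I.load (y + α • r) v = I.bound v := by
  obtain ⟨c, hc, hs, ht⟩ := h.exists_tight
  -- An edge moved by `r` was fractional and still is, so its bounds `0` and `1` cannot be what
  -- stops the step.
  have key : ∀ e : Fin m × Fin n, r e.1 e.2 ≠ 0 → IsFrac (y + α • r) e.1 e.2 := by
    intro e he
    have : e ∈ fracEdges (y + α • r) := by
      rw [hE]
      simpa [fracEdges] using hr.2 _ _ he
    simpa [fracEdges] using this
  rcases c with e | e | v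
  · simp only [slope, slack] at hs ht
    have := (key e (by linarith)).1
    simp only [Pi.add_apply, Pi.smul_apply, smul_eq_mul] at this
    linarith
  · simp only [slope, slack] at hs ht
    have := (key e (by linarith)).2
    simp only [Pi.add_apply, Pi.smul_apply, smul_eq_mul] at this
    linarith
  · refine ⟨v, hc, hs, ?_⟩
    simp only [slope, slack] at hs ht
    rw [load_add_smul]
    linarith

theorem active_congr {y y' : Frac m n} (hE : fracEdges y' = fracEdges y) (v : Row m n s) :
    Active y' v ↔ Active y v := by
  have : ∀ i j, IsFrac y' i j ↔ IsFrac y i j := fun i j => by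
    have := Finset.ext_iff.1 hE (i, j)
    simpa [fracEdges] using this
  exact ⟨fun h => h.mono fun i j => (this i j).1, fun h => h.mono fun i j => (this i j).2⟩

/-- Positive steps in both directions force `r` to be constant on every tight kept row. Tight rows
therefore stay tight, and the row that stops the step is a new one. -/
theorem potential_lt_of_two_sided {y r : Frac m n} {α β : ℝ} (hr : IsDirection y r)
    (hα : I.MaxStep y r α) (hβ : I.MaxStep y (-r) β) :
    I.potential (y + α • r) < I.potential y := by
  have hzero : ∀ v : Row m n s, Active y v → I.load y v = I.bound v → I.load r v = 0 := by
    intro v hv ht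
    have h1 := ((I.keeps_iff _ _).1 hα.2.1).2 v hv
    have h2 := ((I.keeps_iff _ _).1 hβ.2.1).2 v hv
    rw [load_add_smul] at h1 h2
    rw [load_neg] at h2
    have := hα.1
    have := hβ.1
    nlinarith
  refine I.potential_lt_of_loose (fun i j => isFrac_of_add_smul hr) fun hE => .inr ⟨?_, ?_⟩
  · intro j hj
    simp only [looseQueries, Finset.mem_filter, Finset.mem_univ, true_and] at *
    intro ht
    apply hj
    have h0 := hzero (.inr (.inl j)) trivial ht
    have := I.load_add_smul y r α (.inr (.inl j))
    rw [h0, mul_zero, add_zero] at this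
    exact this.trans ht
  · obtain ⟨v, hv, hs, ht⟩ := hα.exists_row hr hE
    rw [Finset.ssubset_iff_of_subset]
    · refine ⟨v, ?_, ?_⟩
      · simp only [looseRows, Finset.mem_filter, Finset.mem_univ, true_and]
        exact ⟨hv, fun h => hs.ne' (hzero v hv h)⟩
      · simp [looseRows, ht]
    · intro v hv
      simp only [looseRows, Finset.mem_filter, Finset.mem_univ, true_and, active_congr hE] at *
      refine ⟨hv.1, fun h => hv.2 ?_⟩
      rw [load_add_smul, hzero v hv.1 h, mul_zero, add_zero, h]

theorem customerLoad_nonpos {z : Frac m n} (h : ∀ j, queryLoad z j ≤ 0) (k : Fin s) :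
    I.customerLoad z k ≤ 0 :=
  Finset.sum_nonpos fun j _ => h j

/-- Cycle breaking increases no row, so only the rounding of a variable can stop it. Lowering a
tight customer may make that customer loose, but apart from rounding only a loose query can stop it,
and tight queries stay tight. This is why loose queries outrank loose rows in the potential. -/
theorem Step.potential_lt {I : AdCell m n s} {y y' : Frac m n} (h : I.Step y y') :
    I.potential y' < I.potential y := by
  obtain ⟨μ, hμ, hy'⟩ := h
  cases hμ with
  | breakCycle z β j₀ _ hz hp hq hq₀ hβ =>
    obtain rfl : y' = y + β • z := by simpa using hy'
    refine I.potential_lt_of_loose (fun i j => isFrac_of_add_smul hz) fun hE => ?_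
    obtain ⟨v, hv, hs, -⟩ := hβ.exists_row hz hE
    have hq' : ∀ j, queryLoad z j ≤ 0 := fun j => by
      by_cases hj : j = j₀
      · exact hj ▸ hq₀
      · exact (hq j hj).le
    exfalso
    rcases v with i | j | k
    · exact hs.ne' (hp i)
    · exact absurd (hq' j) (not_le.2 hs)
    · exact absurd (I.customerLoad_nonpos hq' k) (not_le.2 hs)
  | randMove r α β _ hr hα hβ =>
    simp only [PMF.mix, PMF.mem_support_bind_iff] at hy'
    obtain ⟨b, -, hb⟩ := hy'
    cases b
    · obtain rfl : y' = y + β • (-r) := by simpa [sub_eq_add_neg] using hb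
      exact I.potential_lt_of_two_sided hr.neg hβ (by simpa using hα)
    · obtain rfl : y' = y + α • r := by simpa using hb
      exact I.potential_lt_of_two_sided hr hα hβ
  | lowerTight z β k₀ _ hz hp hq hk hk' hk₀ hβ =>
    obtain rfl : y' = y + β • z := by simpa using hy'
    refine I.potential_lt_of_loose (fun i j => isFrac_of_add_smul hz) fun hE => .inl ?_
    obtain ⟨v, hv, hs, ht⟩ := hβ.exists_row hz hE
    rcases v with i | j | k
    · exact absurd (hp i) hs.ne'
    · rw [Finset.ssubset_iff_of_subset]
      · refine ⟨j, ?_, ?_⟩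
        · simp only [looseQueries, Finset.mem_filter, Finset.mem_univ, true_and]
          exact fun h => hs.ne' (hq j h)
        · simpa [looseQueries] using (show queryLoad (y + β • z) j = I.arrival j from ht)
      · intro j hj
        simp only [looseQueries, Finset.mem_filter, Finset.mem_univ, true_and] at *
        intro h
        apply hj
        have := I.load_add_smul y z β (.inr (.inl j))
        simp only [load, hq j h, mul_zero, add_zero] at this
        exact this.trans h
    · by_cases hkk : k = k₀
      · exact absurd hs (not_lt.2 (hkk ▸ hk₀))
      · exact absurd (hk' k hkk) hs.ne'

theorem length_le_of_steps {y : Frac m n} (N : ℕ) (path : ℕ → Frac m n) (h0 : path 0 = y)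
    (h : ∀ t < N, I.Step (path t) (path (t + 1))) : N ≤ I.potential y := by
  have : ∀ t ≤ N, I.potential (path t) + t ≤ I.potential y := by
    intro t
    induction t with
    | zero => simp [h0]
    | succ t ih =>
      intro ht
      have h1 := (h t (by omega)).potential_lt
      have h2 := ih (by omega)
      omega
  exact le_trans (Nat.le_add_left _ _) (this N le_rfl)

theorem keeps_of_reachable {y y' : Frac m n} (hy : I.Keeps y y)
    (h : Relation.ReflTransGen I.Step y y') : I.Keeps y' y' := by
  induction h with
  | refl => exact hy
  | tail _ h _ => exact h.keeps_self

end AdCell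

/-! ### Counting in graphs and sums -/

/-- A finite forest with an edge has a leaf. -/
theorem SimpleGraph.IsAcyclic.exists_leaf {V : Type*} [Fintype V] {G : SimpleGraph V}
    (hG : G.IsAcyclic) {a b : V} (hab : G.Adj a b) :
    ∃ v w, G.Adj v w ∧ ∀ w', G.Adj v w' → w' = w := by
  by_contra! hcon
  -- Without leaves, paths from `a` could be prolonged forever: in a forest the only neighbour of
  -- the end of a path that lies on the path is the penultimate vertex, so one of two neighbours is
  -- new.
  have key : ∀ L : ℕ, ∃ v : V, ∃ p : G.Walk a v, p.IsPath ∧ p.length = L ∧ ∃ w, G.Adj v w := by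
    intro L
    induction L with
    | zero => exact ⟨a, .nil, .nil, rfl, b, hab⟩
    | succ L ih =>
      obtain ⟨v, p, hp, hL, w, hw⟩ := ih
      obtain ⟨w', hw', hne⟩ := hcon v w hw
      have : ∃ x, G.Adj v x ∧ x ∉ p.support := by
        by_contra! h
        exact hne ((hG.eq_penultimate_of_adj_end hp hw' (h _ hw')).trans
          (hG.eq_penultimate_of_adj_end hp hw (h _ hw)).symm)
      obtain ⟨x, hx, hxp⟩ := this
      exact ⟨x, p.concat hx, hp.concat hxp hx, by simp [hL], v, hx.symm⟩
  obtain ⟨v, p, hp, hL, -⟩ := key (Fintype.card V)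
  exact absurd hp.length_lt (by omega)

/-- A number strictly between `0` and `1` is not the only fractional summand of an integer. -/
theorem Finset.exists_ne_forall_ne_intCast {ι : Type*} {t : Finset ι} {f : ι → ℝ} {a : ι}
    {z : ℤ} (ha : a ∈ t) (h0 : 0 < f a) (h1 : f a < 1) (hz : ∑ i ∈ t, f i = z) :
    ∃ b ∈ t, b ≠ a ∧ ∀ c : ℤ, f b ≠ c := by
  classical
  by_contra! h
  have h' : ∀ b, ∃ c : ℤ, b ∈ t → b ≠ a → f b = c := fun b => by
    by_cases hb : b ∈ t ∧ b ≠ a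
    · obtain ⟨c, hc⟩ := h b hb.1 hb.2
      exact ⟨c, fun _ _ => hc⟩
    · exact ⟨0, fun h1 h2 => absurd ⟨h1, h2⟩ hb⟩
  choose g hg using h'
  rw [← Finset.add_sum_erase t f ha, Finset.sum_congr rfl fun b hb =>
    hg b (Finset.mem_of_mem_erase hb) (Finset.ne_of_mem_erase hb), ← Int.cast_sum] at hz
  have hfa : f a = ((z - ∑ b ∈ t.erase a, g b : ℤ) : ℝ) := by
    push_cast
    push_cast at hz
    linarith
  rw [hfa] at h0 h1
  have h0' : (0 : ℤ) < z - ∑ b ∈ t.erase a, g b := by exact_mod_cast h0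
  have h1' : z - ∑ b ∈ t.erase a, g b < (1 : ℤ) := by exact_mod_cast h1
  omega

namespace AdCell

variable {m n s : ℕ} (I : AdCell m n s)

/-! ### Systems of linear equations whose solutions are moves -/

/-- The combinatorial data on which the choice of a move depends. -/
structure Pattern (m n s : ℕ) where
  customer : Fin n → Fin s
  frac : Fin m → Fin n → Prop
  tightQuery : Fin n → Prop
  tightCustomer : Fin s → Prop

/-- The pattern of a fractional solution. -/
def pattern (y : Frac m n) : Pattern m n s where
  customer := I.customer
  frac := IsFrac y
  tightQuery j := queryLoad y j = I.arrival j
  tightCustomer k := I.customerLoad y k = I.capacity k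

namespace Pattern

variable (P : Pattern m n s)

/-- The graph of the fractional edges. -/
def graph : SimpleGraph (Fin m ⊕ Fin n) :=
  SimpleGraph.fromRel fun a b => ∃ i j, a = Sum.inl i ∧ b = Sum.inr j ∧ P.frac i j

/-- The nonzero solutions `z`, supported on `F`, of the homogeneous equations `C` break a cycle. -/
structure CyclePlan (F : Finset (Fin m × Fin n)) (C : Finset (Row m n s)) (j₀ : Fin n) :
    Prop where
  not_acyclic : ¬ P.graph.IsAcyclic
  frac : ∀ e ∈ F, P.frac e.1 e.2
  card : C.card < F.card
  advertiser : ∀ e ∈ F, .inl e.1 ∈ C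
  query : ∀ e ∈ F, e.2 ≠ j₀ → .inr (.inl e.2) ∈ C

/-- The nonzero solutions, supported on `F`, of the homogeneous equations `C` are directions of a
randomized move. -/
structure RandPlan (F : Finset (Fin m × Fin n)) (C : Finset (Row m n s)) : Prop where
  acyclic : P.graph.IsAcyclic
  frac : ∀ e ∈ F, P.frac e.1 e.2
  card : C.card < F.card
  advertiser : ∀ e ∈ F, 2 ≤ Set.ncard {j | P.frac e.1 j} → .inl e.1 ∈ C
  query : ∀ e ∈ F, P.tightQuery e.2 → .inr (.inl e.2) ∈ C
  customer : ∀ e ∈ F, ¬ P.tightQuery e.2 → P.tightCustomer (P.customer e.2) →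
    .inr (.inr (P.customer e.2)) ∈ C

/-- The nonzero solutions, supported on `F`, of the homogeneous equations `C` lower the tight
customer `k₀`. -/
structure LowerPlan (F : Finset (Fin m × Fin n)) (C : Finset (Row m n s)) (k₀ : Fin s) :
    Prop where
  acyclic : P.graph.IsAcyclic
  frac : ∀ e ∈ F, P.frac e.1 e.2
  card : C.card < F.card
  tight : P.tightCustomer k₀
  advertiser : ∀ e ∈ F, .inl e.1 ∈ C
  query : ∀ e ∈ F, P.tightQuery e.2 → .inr (.inl e.2) ∈ C
  customer : ∀ e ∈ F, ¬ P.tightQuery e.2 → P.customer e.2 ≠ k₀ →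
    .inr (.inr (P.customer e.2)) ∈ C

theorem graph_adj_inl_inr (i : Fin m) (j : Fin n) :
    P.graph.Adj (.inl i) (.inr j) ↔ P.frac i j := by
  simp [graph, SimpleGraph.fromRel_adj]

theorem exists_of_graph_adj {a b : Fin m ⊕ Fin n} (h : P.graph.Adj a b) :
    ∃ e : Fin m × Fin n, P.frac e.1 e.2 ∧ s(a, b) = s(.inl e.1, .inr e.2) := by
  rw [graph, SimpleGraph.fromRel_adj] at h
  obtain ⟨-, ⟨i, j, rfl, rfl, h⟩ | ⟨i, j, rfl, rfl, h⟩⟩ := h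
  · exact ⟨(i, j), h, rfl⟩
  · exact ⟨(i, j), h, Sym2.eq_swap⟩

/-- A cycle has no more vertices than edges. Omitting the equation of one of its queries leaves
fewer equations than unknowns. -/
theorem exists_cyclePlan (h : ¬ P.graph.IsAcyclic) : ∃ F C j₀, P.CyclePlan F C j₀ := by
  classical
  have h' := h
  unfold SimpleGraph.IsAcyclic at h'
  push Not at h'
  obtain ⟨v, c, hc⟩ := h'
  let f : Fin m × Fin n → Sym2 (Fin m ⊕ Fin n) := fun e => s(.inl e.1, .inr e.2)
  let F : Finset (Fin m × Fin n) := {e | f e ∈ c.edges}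
  have hFcard : c.length ≤ F.card := by
    rw [← c.length_edges, ← List.toFinset_card_of_nodup hc.edges_nodup]
    refine le_trans (Finset.card_le_card (t := F.image f) ?_) Finset.card_image_le
    intro e he
    rw [List.mem_toFinset] at he
    obtain ⟨a, b⟩ := e
    obtain ⟨e, he', heq⟩ := P.exists_of_graph_adj (c.adj_of_mem_edges he)
    have heq' : s(a, b) = f e := heq
    refine Finset.mem_image.2 ⟨e, ?_, heq'.symm⟩
    simp only [F, Finset.mem_filter, Finset.mem_univ, true_and]
    exact heq' ▸ he
  -- The walk is closed, so the tail of its support already contains the base point.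
  have hU : c.support.toFinset.card ≤ c.length := by
    have h1 : c.support.toFinset = c.support.tail.toFinset := by
      conv_lhs => rw [← c.cons_tail_support]
      rw [List.toFinset_cons, Finset.insert_eq_of_mem]
      exact List.mem_toFinset.2 (SimpleGraph.Walk.end_mem_tail_support hc.not_nil)
    rw [h1]
    refine (List.toFinset_card_le _).trans ?_
    simp
  have hF : ∀ e ∈ F, Sum.inl e.1 ∈ c.support.toFinset ∧ Sum.inr e.2 ∈ c.support.toFinset := by
    intro e he
    simp only [F, Finset.mem_filter, Finset.mem_univ, true_and] at he
    exact ⟨List.mem_toFinset.2 (c.fst_mem_support_of_mem_edges he),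
      List.mem_toFinset.2 (c.snd_mem_support_of_mem_edges he)⟩
  have hpos : 0 < F.card := lt_of_lt_of_le (by have := hc.three_le_length; omega) hFcard
  obtain ⟨e₀, he₀⟩ := Finset.card_pos.1 hpos
  refine ⟨F, (c.support.toFinset.erase (.inr e₀.2)).image (Sum.map id Sum.inl), e₀.2, h, ?_, ?_,
    ?_, ?_⟩
  · intro e he
    simp only [F, Finset.mem_filter, Finset.mem_univ, true_and] at he
    exact (P.graph_adj_inl_inr _ _).1 (c.adj_of_mem_edges he)
  · refine lt_of_le_of_lt Finset.card_image_le ?_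
    rw [Finset.card_erase_of_mem (hF e₀ he₀).2]
    omega
  · intro e he
    exact Finset.mem_image.2 ⟨.inl e.1, by simpa using (hF e he).1, rfl⟩
  · intro e he hne
    exact Finset.mem_image.2 ⟨.inr e.2, by simpa [hne] using (hF e he).2, rfl⟩

/-- If every tight query and every tight customer with loose queries has at least two fractional
edges, then a forest of fractional edges admits a move. -/
theorem exists_plan_of_acyclic (h : P.graph.IsAcyclic) (hne : ∃ i j, P.frac i j)
    (hq : ∀ i j, P.frac i j → P.tightQuery j → ∃ i', i' ≠ i ∧ P.frac i' j)
    (hk : ∀ i j, P.frac i j → ¬ P.tightQuery j → P.tightCustomer (P.customer j) →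
      ∃ i' j', j' ≠ j ∧ P.frac i' j' ∧ ¬ P.tightQuery j' ∧ P.customer j' = P.customer j) :
    ∃ F C, P.RandPlan F C ∨ ∃ k₀, P.LowerPlan F C k₀ := by
  classical
  let E : Finset (Fin m × Fin n) := {e | P.frac e.1 e.2}
  have hE : ∀ e, e ∈ E ↔ P.frac e.1 e.2 := fun e => by simp [E]
  -- Contract all loose queries of a customer to one vertex: `q e` is the end of `e` opposite to the
  -- advertiser, and `D` below is the degree in the contracted multigraph.
  let q : Fin m × Fin n → Row m n s := fun e =>
    if P.tightQuery e.2 then .inr (.inl e.2) else .inr (.inr (P.customer e.2))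
  have hqt : ∀ e, P.tightQuery e.2 → q e = .inr (.inl e.2) := fun e he => by simp [q, he]
  have hqn : ∀ e, ¬ P.tightQuery e.2 → q e = .inr (.inr (P.customer e.2)) := fun e he => by
    simp [q, he]
  let D : Row m n s → ℕ := fun v => (E.filter fun e => Sum.inl e.1 = v).card +
    (E.filter fun e => q e = v).card
  have hD : ∑ v, D v = 2 * E.card := by
    simp only [D, Finset.sum_add_distrib]
    rw [← Finset.card_eq_sum_card_fiberwise
        (f := fun e : Fin m × Fin n => (Sum.inl e.1 : Row m n s))
      fun _ _ => Finset.mem_coe.2 (Finset.mem_univ _),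
      ← Finset.card_eq_sum_card_fiberwise (f := q) fun _ _ => Finset.mem_coe.2 (Finset.mem_univ _)]
    omega
  -- These are the rows that a randomized move must preserve. Each has degree at least two in the
  -- contracted graph, whence `2 * C.card ≤ 2 * E.card`.
  let C : Finset (Row m n s) := Finset.univ.filter fun v => match v with
    | .inl i => 2 ≤ Set.ncard {j | P.frac i j}
    | .inr (.inl j) => P.tightQuery j ∧ ∃ i, P.frac i j
    | .inr (.inr k) => P.tightCustomer k ∧ ∃ i j, P.frac i j ∧ ¬ P.tightQuery j ∧ P.customer j = k
  have hC1 : ∀ i, (Sum.inl i : Row m n s) ∈ C ↔ 2 ≤ Set.ncard {j | P.frac i j} := fun i => by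
    simp [C]
  have hC2 : ∀ j, (Sum.inr (.inl j) : Row m n s) ∈ C ↔ P.tightQuery j ∧ ∃ i, P.frac i j :=
    fun j => by simp [C]
  have hC3 : ∀ k, (Sum.inr (.inr k) : Row m n s) ∈ C ↔ P.tightCustomer k ∧
      ∃ i j, P.frac i j ∧ ¬ P.tightQuery j ∧ P.customer j = k := fun k => by simp [C]
  have hdeg : ∀ v ∈ C, 2 ≤ D v := by
    intro v hv
    rcases v with i | j | k
    · obtain ⟨a, ha, b, hb, hab⟩ := (Set.one_lt_ncard (Set.toFinite _)).1
        (show 1 < Set.ncard {j | P.frac i j} from (hC1 i).1 hv)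
      refine le_trans ?_ (Nat.le_add_right _ _)
      exact Finset.one_lt_card.2 ⟨(i, a), by simpa [hE] using ha, (i, b), by simpa [hE] using hb,
        by simp [hab]⟩
    · obtain ⟨ht, i, hi⟩ := (hC2 j).1 hv
      obtain ⟨i', hne, hi'⟩ := hq i j hi ht
      refine le_trans ?_ (Nat.le_add_left _ _)
      exact Finset.one_lt_card.2 ⟨(i', j), by simpa [hE, hqt (i', j) ht] using hi', (i, j),
        by simpa [hE, hqt (i, j) ht] using hi, by simp [hne]⟩
    · obtain ⟨ht, i, j, hij, hj, hk'⟩ := (hC3 k).1 hv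
      subst hk'
      obtain ⟨i', j', hne, hij', hj', hk'⟩ := hk i j hij hj ht
      refine le_trans ?_ (Nat.le_add_left _ _)
      exact Finset.one_lt_card.2 ⟨(i', j'), by simpa [hE, hqn (i', j') hj', hk'] using hij', (i, j),
        by simpa [hE, hqn (i, j) hj] using hij, by simp [hne]⟩
  have hCsum : C.card * 2 ≤ ∑ v ∈ C, D v := by
    simpa using Finset.card_nsmul_le_sum C D 2 hdeg
  have hCle : ∑ v ∈ C, D v ≤ ∑ v, D v :=
    Finset.sum_le_sum_of_subset (Finset.subset_univ C)
  rcases lt_or_ge C.card E.card with hlt | hge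
  · refine ⟨E, C, .inl ⟨h, fun e he => (hE e).1 he, hlt, fun e he h2 => (hC1 _).2 h2,
      fun e he ht => (hC2 _).2 ⟨ht, e.1, (hE e).1 he⟩,
      fun e he hn ht => (hC3 _).2 ⟨ht, e.1, e.2, (hE e).1 he, hn, rfl⟩⟩⟩
  -- If `C` is not smaller than `E`, the double count is an equality, so all edges have both ends in
  -- `C`.
  have hout : ∀ v, v ∉ C → D v = 0 := by
    intro v hv
    have h1 : ∑ u ∈ C, D u + ∑ u ∈ Cᶜ, D u = ∑ u, D u := Finset.sum_add_sum_compl C D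
    have h2 : D v ≤ ∑ u ∈ Cᶜ, D u :=
      Finset.single_le_sum (f := D) (fun _ _ => Nat.zero_le _) (Finset.mem_compl.2 hv)
    omega
  have hadv : ∀ e ∈ E, (Sum.inl e.1 : Row m n s) ∈ C := by
    intro e he
    by_contra hv
    have := hout _ hv
    simp only [D, Nat.add_eq_zero_iff, Finset.card_eq_zero] at this
    exact Finset.notMem_empty e (this.1 ▸ Finset.mem_filter.2 ⟨he, rfl⟩)
  have hend : ∀ e ∈ E, q e ∈ C := by
    intro e he
    by_contra hv
    have := hout _ hv
    simp only [D, Nat.add_eq_zero_iff, Finset.card_eq_zero] at this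
    exact Finset.notMem_empty e (this.2 ▸ Finset.mem_filter.2 ⟨he, rfl⟩)
  -- Dropping the equation of one tight customer makes the system underdetermined. All payments are
  -- among the remaining equations, as deterministic moves require.
  by_cases hcust : ∃ k, (Sum.inr (.inr k) : Row m n s) ∈ C
  · obtain ⟨k₀, hk₀⟩ := hcust
    refine ⟨E, C.erase (.inr (.inr k₀)), .inr ⟨k₀, h, fun e he => (hE e).1 he, ?_,
      ((hC3 k₀).1 hk₀).1, fun e he => ?_, fun e he ht => ?_, fun e he ht hne => ?_⟩⟩
    · have : 0 < C.card := Finset.card_pos.2 ⟨_, hk₀⟩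
      rw [Finset.card_erase_of_mem hk₀]
      omega
    · simpa using hadv e he
    · simpa [hqt _ ht] using hend e he
    · simpa [hqn _ ht, hne] using hend e he
  -- With no customer in `C` all queries with fractional edges are tight, so nothing is contracted
  -- and all degrees are at least two, which a leaf of the forest contradicts.
  · exfalso
    have htight : ∀ i j, P.frac i j → P.tightQuery j := by
      intro i j hij
      by_contra ht
      have := hend (i, j) ((hE _).2 hij)
      rw [hqn _ ht] at this
      exact hcust ⟨_, this⟩
    obtain ⟨i, j, hij⟩ := hne
    obtain ⟨v, w, hvw, huniq⟩ := h.exists_leaf ((P.graph_adj_inl_inr i j).2 hij)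
    obtain ⟨e, he, heq⟩ := P.exists_of_graph_adj hvw
    rcases Sym2.eq_iff.1 heq with ⟨rfl, rfl⟩ | ⟨rfl, rfl⟩
    · obtain ⟨a, ha, hne⟩ := Set.exists_ne_of_one_lt_ncard
        (show 1 < Set.ncard {j | P.frac e.1 j} from (hC1 _).1 (hadv e ((hE e).2 he))) e.2
      exact hne (Sum.inr_injective (huniq (.inr a) ((P.graph_adj_inl_inr _ _).2 ha)))
    · obtain ⟨i', hne, hi'⟩ := hq _ _ he (htight _ _ he)
      exact hne (Sum.inl_injective
        (huniq (.inl i') ((P.graph_adj_inl_inr _ _).2 hi').symm))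

end Pattern

/-! ### Integrality of arrivals and capacities -/

theorem exists_intCast_of_not_isFrac {y : Frac m n} (hy : Box y) {i : Fin m} {j : Fin n}
    (h : ¬ IsFrac y i j) : ∃ c : ℤ, y i j = c := by
  rcases eq_of_not_isFrac hy h with h | h
  · exact ⟨0, by simp [h]⟩
  · exact ⟨1, by simp [h]⟩

theorem exists_intCast_arrival (j : Fin n) : ∃ c : ℤ, I.arrival j = c := by
  unfold arrival
  split_ifs
  · exact ⟨1, by simp⟩
  · exact ⟨0, by simp⟩

theorem arrival_le_one (j : Fin n) : I.arrival j ≤ 1 := by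
  unfold arrival
  split_ifs <;> simp

theorem exists_intCast_queryLoad {y : Frac m n} (hy : Box y) {j : Fin n}
    (h : ∀ i, ¬ IsFrac y i j) : ∃ c : ℤ, queryLoad y j = c := by
  choose g hg using fun i => exists_intCast_of_not_isFrac hy (h i)
  exact ⟨∑ i, g i, by simp [queryLoad, hg]⟩

/-- Arrivals and capacities are integers, so a tight sum with one summand strictly between `0` and
`1` has a second non-integral summand. A loose query with a fractional edge has load strictly
between `0` and `1`. A query with non-integral load is loose and has a fractional edge. -/
theorem exists_plan {y : Frac m n} (hy : I.Keeps y y) (hr : ¬ Rounded y) :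
    ∃ F C, (∃ j₀, (I.pattern y).CyclePlan F C j₀) ∨ (I.pattern y).RandPlan F C ∨
      ∃ k₀, (I.pattern y).LowerPlan F C k₀ := by
  obtain ⟨hbox, hassign, hcap, -⟩ := hy
  by_cases hac : (I.pattern y).graph.IsAcyclic
  · have hne : ∃ i j, (I.pattern y).frac i j := by
      by_contra! h
      exact hr fun i j => eq_of_not_isFrac hbox (h i j)
    suffices h : ∃ F C, (I.pattern y).RandPlan F C ∨ ∃ k₀, (I.pattern y).LowerPlan F C k₀ by
      obtain ⟨F, C, h⟩ := h
      exact ⟨F, C, .inr h⟩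
    refine (I.pattern y).exists_plan_of_acyclic hac hne ?_ ?_
    · intro i j hij ht
      obtain ⟨z, hz⟩ := I.exists_intCast_arrival j
      obtain ⟨i', -, hne, h'⟩ := Finset.exists_ne_forall_ne_intCast (t := Finset.univ)
        (f := fun i => y i j) (a := i) (z := z) (Finset.mem_univ _) hij.1 hij.2
        ((show queryLoad y j = I.arrival j from ht).trans hz)
      refine ⟨i', hne, ?_⟩
      by_contra hf
      obtain ⟨c, hc⟩ := exists_intCast_of_not_isFrac hbox hf
      exact h' c hc
    · intro i j hij hnt ht
      have h1 : 0 < queryLoad y j := lt_of_lt_of_le hij.1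
        (Finset.single_le_sum (f := fun i => y i j) (fun i _ => (hbox i j).1) (Finset.mem_univ i))
      have h2 : queryLoad y j < 1 :=
        lt_of_lt_of_le (lt_of_le_of_ne (hassign j) hnt) (I.arrival_le_one j)
      obtain ⟨j', hj', hne, h'⟩ := Finset.exists_ne_forall_ne_intCast
        (t := Finset.univ.filter fun j' => I.customer j' = I.customer j)
        (f := fun j' => queryLoad y j') (a := j) (z := (I.capacity (I.customer j) : ℤ))
        (by simp) h1 h2
        ((show I.customerLoad y (I.customer j) = I.capacity (I.customer j) from ht).trans
          (by simp))
      have hfr : ∃ i', IsFrac y i' j' := by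
        by_contra! hf
        obtain ⟨c, hc⟩ := exists_intCast_queryLoad hbox hf
        exact h' c hc
      obtain ⟨i', hi'⟩ := hfr
      refine ⟨i', j', hne, hi', fun ht' => ?_, (Finset.mem_filter.1 hj').2⟩
      obtain ⟨c, hc⟩ := I.exists_intCast_arrival j'
      exact h' c ((show queryLoad y j' = I.arrival j' from ht').trans hc)
  · obtain ⟨F, C, j₀, h⟩ := (I.pattern y).exists_cyclePlan hac
    exact ⟨F, C, .inl ⟨j₀, h⟩⟩

/-! ### From solutions of the equations to moves -/

/-- `z` is a nonzero solution, supported on `F`, of the homogeneous equations `C`. -/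
structure Solves (F : Finset (Fin m × Fin n)) (C : Finset (Row m n s)) (z : Frac m n) : Prop where
  ne_zero : z ≠ 0
  support : ∀ e : Fin m × Fin n, e ∉ F → z e.1 e.2 = 0
  load : ∀ v ∈ C, I.load z v = 0

variable {I} {F : Finset (Fin m × Fin n)} {C : Finset (Row m n s)} {y z : Frac m n}

theorem Solves.neg (h : I.Solves F C z) : I.Solves F C (-z) :=
  ⟨neg_ne_zero.2 h.ne_zero, fun e he => by simp [h.support e he],
    fun v hv => by rw [load_neg, h.load v hv, neg_zero]⟩

theorem Solves.isDirection (h : I.Solves F C z) (hF : ∀ e ∈ F, IsFrac y e.1 e.2) :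
    IsDirection y z := by
  refine ⟨h.ne_zero, fun i j hij => ?_⟩
  by_contra hf
  exact hij (h.support (i, j) fun he => hf (hF _ he))

theorem Solves.payment_eq_zero (h : I.Solves F C z) (i : Fin m)
    (hC : ∀ e ∈ F, e.1 = i → .inl i ∈ C) : I.payment z i = 0 := by
  by_cases hi : ∃ e ∈ F, e.1 = i
  · obtain ⟨e, he, hei⟩ := hi
    exact h.load _ (hC e he hei)
  · exact Finset.sum_eq_zero fun j _ => by
      rw [h.support (i, j) fun he => hi ⟨_, he, rfl⟩, zero_mul]

theorem Solves.queryLoad_eq_zero (h : I.Solves F C z) (j : Fin n)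
    (hC : ∀ e ∈ F, e.2 = j → .inr (.inl j) ∈ C) : queryLoad z j = 0 := by
  by_cases hj : ∃ e ∈ F, e.2 = j
  · obtain ⟨e, he, hej⟩ := hj
    exact h.load _ (hC e he hej)
  · exact Finset.sum_eq_zero fun i _ => h.support (i, j) fun he => hj ⟨_, he, rfl⟩

theorem Solves.customerLoad_eq_zero (h : I.Solves F C z) (k : Fin s)
    (hC : ∀ e ∈ F, I.customer e.2 = k → .inr (.inl e.2) ∈ C ∨ .inr (.inr k) ∈ C) :
    I.customerLoad z k = 0 := by
  by_cases hk : .inr (.inr k) ∈ C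
  · exact h.load _ hk
  · refine Finset.sum_eq_zero fun j hj => h.queryLoad_eq_zero j fun e he hej => ?_
    subst hej
    exact (hC e he (by simpa using hj)).resolve_right hk

/-- The slack allows a step of positive length along `z`. -/
def Allows (I : AdCell m n s) (y z : Frac m n) : Prop :=
  ∀ v, Active y v → 0 < I.load z v → I.load y v < I.bound v

theorem Solves.breakCycle {j₀ : Fin n} (h : I.Solves F C z)
    (hP : (I.pattern y).CyclePlan F C j₀) (h0 : queryLoad z j₀ ≤ 0) :
    I.Allows y z ∧ ∀ β, I.MaxStep y z β → I.Move y (PMF.pure (y + β • z)) := by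
  have hp : ∀ i, I.payment z i = 0 := fun i => h.payment_eq_zero i fun e he hei =>
    hei ▸ hP.advertiser e he
  have hq : ∀ j, j ≠ j₀ → queryLoad z j = 0 := fun j hj => h.queryLoad_eq_zero j fun e he hej =>
    hej ▸ hP.query e he (hej ▸ hj)
  have hq' : ∀ j, queryLoad z j ≤ 0 := fun j => by
    by_cases hj : j = j₀
    · exact hj ▸ h0
    · exact (hq j hj).le
  refine ⟨?_, fun β hβ => .breakCycle z β j₀ hP.not_acyclic (h.isDirection hP.frac) hp hq h0 hβ⟩
  rintro (i | j | k) - hv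
  · exact absurd (hp i) hv.ne'
  · exact absurd hv (not_lt.2 (hq' j))
  · exact absurd hv (not_lt.2 (I.customerLoad_nonpos hq' k))

theorem Solves.allows_of_randPlan (h : I.Solves F C z) (hy : I.Keeps y y)
    (hP : (I.pattern y).RandPlan F C) : I.Allows y z := by
  intro v hv hpos
  refine lt_of_le_of_ne (((I.keeps_iff _ _).1 hy).2 v hv) fun ht => hpos.ne' ?_
  rcases v with i | j | k
  · exact h.payment_eq_zero i fun e he hei => hei ▸ hP.advertiser e he (hei ▸ hv)
  · exact h.queryLoad_eq_zero j fun e he hej => hej ▸ hP.query e he (hej ▸ ht)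
  · refine h.customerLoad_eq_zero k fun e he hek => ?_
    by_cases hq : (I.pattern y).tightQuery e.2
    · exact .inl (hP.query e he hq)
    · exact .inr (hek ▸ hP.customer e he hq
        (show I.customerLoad y (I.customer e.2) = I.capacity (I.customer e.2) from hek ▸ ht))

theorem Solves.randMove (h : I.Solves F C z) (hP : (I.pattern y).RandPlan F C) {α β : ℝ}
    (hα : I.MaxStep y z α) (hβ : I.MaxStep y (-z) β) :
    I.Move y (PMF.mix (β / (α + β)) (PMF.pure (y + α • z)) (PMF.pure (y - β • z))) :=
  .randMove z α β hP.acyclic (h.isDirection hP.frac) hα hβ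

theorem Solves.lowerTight {k₀ : Fin s} (h : I.Solves F C z) (hy : I.Keeps y y)
    (hP : (I.pattern y).LowerPlan F C k₀) (h0 : I.customerLoad z k₀ ≤ 0) :
    I.Allows y z ∧ ∀ β, I.MaxStep y z β → I.Move y (PMF.pure (y + β • z)) := by
  have hp : ∀ i, I.payment z i = 0 := fun i => h.payment_eq_zero i fun e he hei =>
    hei ▸ hP.advertiser e he
  have hq : ∀ j, queryLoad y j = I.arrival j → queryLoad z j = 0 := fun j hj =>
    h.queryLoad_eq_zero j fun e he hej => hej ▸ hP.query e he (hej ▸ hj)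
  have hk : ∀ k, k ≠ k₀ → I.customerLoad z k = 0 := fun k hk =>
    h.customerLoad_eq_zero k fun e he hek => by
      by_cases hq : (I.pattern y).tightQuery e.2
      · exact .inl (hP.query e he hq)
      · exact .inr (hek ▸ hP.customer e he hq
          (show I.customer e.2 ≠ k₀ from hek ▸ hk))
  refine ⟨?_, fun β hβ => .lowerTight z β k₀ hP.acyclic (h.isDirection hP.frac) hp hq hP.tight hk
    h0 hβ⟩
  rintro (i | j | k) - hv
  · exact absurd (hp i) hv.ne'
  · exact lt_of_le_of_ne (hy.2.1 j) fun ht => hv.ne' (hq j ht)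
  · by_cases hkk : k = k₀
    · exact absurd hv (not_lt.2 (hkk ▸ h0))
    · exact absurd (hk k hkk) hv.ne'

end AdCell

/-! ### Expectations -/

theorem PMF.mix_apply {α : Type*} (p : ℝ) (D₁ D₂ : PMF α) (a : α) :
    PMF.mix p D₁ D₂ a =
      min (ENNReal.ofReal p) 1 * D₁ a + (1 - min (ENNReal.ofReal p) 1) * D₂ a := by
  simp [PMF.mix, PMF.bind_apply, realCoin]

theorem PMF.mix_bind {α β : Type*} (p : ℝ) (D₁ D₂ : PMF α) (K : α → PMF β) :
    (PMF.mix p D₁ D₂).bind K = PMF.mix p (D₁.bind K) (D₂.bind K) := by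
  unfold PMF.mix
  rw [PMF.bind_bind]
  congr 1
  funext b
  cases b <;> simp

theorem PMF.mem_support_mix {α : Type*} {p : ℝ} {D₁ D₂ : PMF α} {a : α}
    (h : a ∈ (PMF.mix p D₁ D₂).support) : a ∈ D₁.support ∨ a ∈ D₂.support := by
  simp only [PMF.mix, PMF.mem_support_bind_iff] at h
  obtain ⟨b, -, hb⟩ := h
  cases b
  · exact .inr (by simpa using hb)
  · exact .inl (by simpa using hb)

theorem PMF.mem_support_mix_left {α : Type*} {p : ℝ} (hp : 0 < p) {D₁ D₂ : PMF α} {a : α}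
    (h : a ∈ D₁.support) : a ∈ (PMF.mix p D₁ D₂).support := by
  rw [PMF.mem_support_iff] at *
  rw [PMF.mix_apply]
  simp [h, hp]

theorem PMF.mem_support_mix_right {α : Type*} {p : ℝ} (hp : p < 1) {D₁ D₂ : PMF α} {a : α}
    (h : a ∈ D₂.support) : a ∈ (PMF.mix p D₁ D₂).support := by
  rw [PMF.mem_support_iff] at *
  rw [PMF.mix_apply]
  have : min (ENNReal.ofReal p) 1 < 1 := by simp [hp]
  simp only [ne_eq, add_eq_zero, mul_eq_zero, h, or_false, not_and]
  exact fun _ h => absurd (tsub_eq_zero_iff_le.1 h) (not_le.2 this)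

section Expect

variable {α : Type*} [Fintype α]

theorem PMF.expect_pure (a : α) (f : α → ℝ) : (PMF.pure a).expect f = f a := by
  classical
  simp only [PMF.expect, PMF.pure_apply]
  rw [Finset.sum_eq_single a] <;> simp +contextual

theorem PMF.expect_mix {p : ℝ} (h0 : 0 ≤ p) (h1 : p ≤ 1) (D₁ D₂ : PMF α) (f : α → ℝ) :
    (PMF.mix p D₁ D₂).expect f = p * D₁.expect f + (1 - p) * D₂.expect f := by
  simp only [PMF.expect, Finset.mul_sum, ← Finset.sum_add_distrib]
  refine Finset.sum_congr rfl fun a _ => ?_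
  have hm : min (ENNReal.ofReal p) 1 = ENNReal.ofReal p := by simp [h1]
  have h2 : (1 : ENNReal) - ENNReal.ofReal p = ENNReal.ofReal (1 - p) := by
    rw [ENNReal.ofReal_sub 1 h0, ENNReal.ofReal_one]
  rw [PMF.mix_apply, hm, h2, ENNReal.toReal_add (ENNReal.mul_ne_top ENNReal.ofReal_ne_top
    (D₁.apply_ne_top a)) (ENNReal.mul_ne_top ENNReal.ofReal_ne_top (D₂.apply_ne_top a)),
    ENNReal.toReal_mul, ENNReal.toReal_mul, ENNReal.toReal_ofReal h0,
    ENNReal.toReal_ofReal (by linarith)]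
  ring

theorem PMF.expect_sum {ι : Type*} (t : Finset ι) (D : PMF α) (f : ι → α → ℝ) :
    D.expect (fun a => ∑ i ∈ t, f i a) = ∑ i ∈ t, D.expect (f i) := by
  simp only [PMF.expect, Finset.mul_sum]
  exact Finset.sum_comm

end Expect

namespace AdCell

variable {m n s : ℕ} {I : AdCell m n s}

/-! ### The expected revenue -/

theorem Move.mem_support_step {y y' : Frac m n} {μ : PMF (Frac m n)} (h : I.Move y μ)
    (hy' : y' ∈ μ.support) : I.Step y y' := ⟨μ, h, hy'⟩

/-- A move replaces `y` by one solution, or by one of two solutions whose mean is `y`. In the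
first case all payments stay the same. -/
theorem Move.deterministic_or_mean {y : Frac m n} {μ : PMF (Frac m n)} (h : I.Move y μ) :
    (∃ y', μ = PMF.pure y' ∧ ∀ i, I.payment y' i = I.payment y i) ∨
    ∃ p y₁ y₂, 0 < p ∧ p < 1 ∧ μ = PMF.mix p (PMF.pure y₁) (PMF.pure y₂) ∧
      y = p • y₁ + (1 - p) • y₂ := by
  cases h with
  | breakCycle z β j₀ _ hz hp _ _ hβ =>
    refine .inl ⟨_, rfl, fun i => ?_⟩
    have := I.load_add_smul y z β (.inl i)
    simp only [load, hp i, mul_zero, add_zero] at this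
    exact this
  | randMove r α β _ hr hα hβ =>
    have h1 := hα.1
    have h2 := hβ.1
    refine .inr ⟨β / (α + β), _, _, by positivity, ?_, rfl, ?_⟩
    · rw [div_lt_one (by positivity)]
      linarith
    · ext i j
      simp only [Pi.add_apply, Pi.sub_apply, Pi.smul_apply, smul_eq_mul]
      field_simp
      ring
  | lowerTight z β k₀ _ hz hp _ _ _ _ hβ =>
    refine .inl ⟨_, rfl, fun i => ?_⟩
    have := I.load_add_smul y z β (.inl i)
    simp only [load, hp i, mul_zero, add_zero] at this
    exact this

/-- Induction over the executions of the rounding. -/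
theorem Rounds.expect_induction {f : Alloc m n → ℝ} {Inv : Frac m n → Prop} {g : Frac m n → ℝ}
    (hstep : ∀ y y', Inv y → I.Step y y' → Inv y')
    (hdone : ∀ X : Alloc m n, Inv X.toFrac → g X.toFrac ≤ f X)
    (hpure : ∀ y y', Inv y → I.Step y y' → (∀ i, I.payment y' i = I.payment y i) → g y ≤ g y')
    (hmix : ∀ p y y₁ y₂, Inv y → I.Step y y₁ → I.Step y y₂ → y = p • y₁ + (1 - p) • y₂ →
      g y ≤ p * g y₁ + (1 - p) * g y₂)
    {y : Frac m n} {D : PMF (Alloc m n)} (h : I.Rounds y D) (hy : Inv y) :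
    g y ≤ D.expect f := by
  induction h with
  | done X => rw [PMF.expect_pure]; exact hdone X hy
  | move y μ K hμ _ ih =>
    rcases hμ.deterministic_or_mean with ⟨y', rfl, hp⟩ | ⟨p, y₁, y₂, h0, h1, rfl, hm⟩
    · have hs : I.Step y y' := hμ.mem_support_step (by simp)
      rw [PMF.pure_bind]
      exact (hpure y y' hy hs hp).trans (ih y' (by simp) (hstep y y' hy hs))
    · have m1 : y₁ ∈ (PMF.mix p (PMF.pure y₁) (PMF.pure y₂)).support :=
        PMF.mem_support_mix_left h0 (by simp)
      have m2 : y₂ ∈ (PMF.mix p (PMF.pure y₁) (PMF.pure y₂)).support :=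
        PMF.mem_support_mix_right h1 (by simp)
      have s1 := hμ.mem_support_step m1
      have s2 := hμ.mem_support_step m2
      rw [PMF.mix_bind, PMF.pure_bind, PMF.pure_bind, PMF.expect_mix h0.le h1.le]
      have i1 := mul_le_mul_of_nonneg_left (ih y₁ m1 (hstep y y₁ hy s1)) h0.le
      have i2 := mul_le_mul_of_nonneg_left (ih y₂ m2 (hstep y y₂ hy s2)) (sub_nonneg.2 h1.le)
      have := hmix p y y₁ y₂ hy s1 s2 hm
      linarith

theorem Rounds.feasible {y : Frac m n} {D : PMF (Alloc m n)} (h : I.Rounds y D)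
    (hy : I.Keeps y y) : ∀ X ∈ D.support, I.Feasible X := by
  induction h with
  | done X =>
    intro X' hX'
    obtain rfl : X' = X := by simpa using hX'
    exact ⟨hy.2.1, hy.2.2.1⟩
  | move y μ K hμ _ ih =>
    intro X hX
    obtain ⟨y', hy', hX⟩ := (PMF.mem_support_bind_iff _ _ _).1 hX
    exact ih y' hy' (hμ.mem_support_step hy').keeps_self X hX

/-! ### Expected capped payment of one advertiser -/

/-- What an advertiser pays outside of query `j`. -/
def otherPayment (I : AdCell m n s) (x : Frac m n) (i : Fin m) (j : Fin n) : ℝ :=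
  ∑ j' ∈ Finset.univ.erase j, x i j' * I.bid i j'

theorem payment_eq_otherPayment_add (I : AdCell m n s) (x : Frac m n) (i : Fin m) (j : Fin n) :
    I.payment x i = I.otherPayment x i j + x i j * I.bid i j := by
  rw [payment, otherPayment, add_comm,
    Finset.add_sum_erase Finset.univ (fun j => x i j * I.bid i j) (Finset.mem_univ j)]

/-- A step does not change the variables that are rounded. -/
theorem Step.eq_of_not_isFrac {y y' : Frac m n} (h : I.Step y y') {i : Fin m} {j : Fin n}
    (hf : ¬ IsFrac y i j) : y' i j = y i j := by
  obtain ⟨r, α, hr, -, rfl⟩ := h.exists_maxStep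
  have : r i j = 0 := by
    by_contra h0
    exact hf (hr.2 i j h0)
  simp [this]

/-- Once only the edge `(i, j)` is fractional among the edges of `i`, the expected revenue from `i`
is determined. -/
theorem Rounds.expect_of_single_edge {y : Frac m n} {D : PMF (Alloc m n)} (h : I.Rounds y D)
    (i : Fin m) (j : Fin n) (hj : ∀ j', IsFrac y i j' → j' = j) :
    (1 - y i j) * min (I.otherPayment y i j) (I.budget i) +
      y i j * min (I.otherPayment y i j + I.bid i j) (I.budget i) ≤
    D.expect fun X => min (I.payment X.toFrac i) (I.budget i) := by
  have hother : ∀ y y' : Frac m n, (∀ j', IsFrac y i j' → j' = j) → I.Step y y' →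
      I.otherPayment y' i j = I.otherPayment y i j := by
    intro y y' hy hs
    refine Finset.sum_congr rfl fun j' hj' => ?_
    rw [hs.eq_of_not_isFrac fun hf => Finset.ne_of_mem_erase hj' (hy j' hf)]
  -- The payment on the other edges is frozen, so `g` is affine in the value of the edge. Randomized
  -- moves thus preserve it on average, and at `0` and `1` it is the capped payment.
  refine Rounds.expect_induction (I := I) (Inv := fun y => ∀ j', IsFrac y i j' → j' = j)
    (g := fun y => (1 - y i j) * min (I.otherPayment y i j) (I.budget i) +
      y i j * min (I.otherPayment y i j + I.bid i j) (I.budget i)) ?_ ?_ ?_ ?_ h hj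
  · exact fun y y' hy hs j' hf => hy j' (hs.isFrac hf)
  · intro X _
    rw [I.payment_eq_otherPayment_add _ i j]
    by_cases hX : X i j <;> simp [Alloc.toFrac, hX]
  · intro y y' hy hs hp
    have ho := hother y y' hy hs
    have hpi := hp i
    rw [I.payment_eq_otherPayment_add y' i j, I.payment_eq_otherPayment_add y i j, ho] at hpi
    have : y' i j * I.bid i j = y i j * I.bid i j := by linarith
    rw [ho]
    -- Equal payments leave the edge unchanged unless its bid is `0`, and then `g` does not depend
    -- on the edge.
    rcases mul_eq_mul_right_iff.1 this with h | h
    · rw [h]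
    · rw [h]
      apply le_of_eq
      simp only [add_zero]
      ring
  · intro p y y₁ y₂ hy h1 h2 hm
    rw [hother y y₁ hy h1, hother y y₂ hy h2]
    have : y i j = p * y₁ i j + (1 - p) * y₂ i j := by
      conv_lhs => rw [hm]
      simp
    rw [this]
    apply le_of_eq
    ring

/-- The loss of an advertiser by the budget cap when its last edge is rounded. -/
theorem one_sub_mul_le_of_last_edge {a b p B ε : ℝ} (ha : 0 ≤ a) (hb : 0 ≤ b) (hp0 : 0 ≤ p)
    (hB : 0 < B) (hε : b ≤ ε * B) (h : a + p * b ≤ B) :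
    (1 - ε / 4) * (a + p * b) ≤ (1 - p) * min a B + p * min (a + b) B := by
  have hε0 : 0 ≤ ε := by
    by_contra hneg
    nlinarith
  have hq : 0 ≤ a + p * b := by positivity
  have haB : a ≤ B := by nlinarith
  rw [min_eq_left haB]
  rcases le_total (a + b) B with hab | hab
  · rw [min_eq_left hab]
    nlinarith
  · rw [min_eq_right hab]
    -- The right-hand side of the goal is `a + p * b` minus the loss `p * (a + b - B)`, and `b ≤ ε *
    -- B`.
    suffices h : p * (a + b - B) * (4 * B) ≤ b * (a + p * b) by
      have h2 : b * (a + p * b) ≤ ε * B * (a + p * b) := mul_le_mul_of_nonneg_right hε hq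
      have h3 : p * (a + b - B) * 4 ≤ ε * (a + p * b) := by
        by_contra! hlt
        nlinarith
      nlinarith
    -- The difference of the two sides is affine in `a` with slope `b - 4 * B * p`, so it is least
    -- at an end of the range of `a`. It is `p * (b - 2 * B) ^ 2` at `a = 0` and `B * b * (1 - 2 *
    -- p) ^ 2` at `a = B - p * b`.
    rcases le_total (4 * B * p) b with hc | hc
    · nlinarith [mul_nonneg ha (sub_nonneg.2 hc), mul_nonneg hp0 (sq_nonneg (b - 2 * B))]
    · nlinarith [mul_nonneg (sub_nonneg.2 h) (sub_nonneg.2 hc),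
        mul_nonneg (mul_nonneg hB.le hb) (sq_nonneg (1 - 2 * p))]

/-- With at least two fractional edges the expected payment is preserved and the budget respected,
so the claim passes from the outcomes back to `y`. With at most one, the bound for the last edge
applies. -/
theorem Rounds.expect_advertiser {y : Frac m n} {D : PMF (Alloc m n)} (h : I.Rounds y D)
    (hy : I.Keeps y y) {i : Fin m} (hi : I.payment y i ≤ I.budget i) {ε : ℝ}
    (hε : ∀ j, I.bid i j ≤ ε * I.budget i) :
    (1 - ε / 4) * I.payment y i ≤ D.expect fun X => min (I.payment X.toFrac i) (I.budget i) := by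
  have single : ∀ (y : Frac m n) (D : PMF (Alloc m n)), I.Rounds y D → I.Keeps y y →
      I.payment y i ≤ I.budget i → advDegree y i < 2 →
      (1 - ε / 4) * I.payment y i ≤ D.expect fun X => min (I.payment X.toFrac i) (I.budget i) := by
    intro y D h hy hi hdeg
    rcases Nat.eq_zero_or_pos n with rfl | hn
    · simp only [payment, Finset.univ_eq_empty, Finset.sum_empty, mul_zero,
        min_eq_left (I.budget_pos i).le]
      simp [PMF.expect]
    obtain ⟨j, hj⟩ : ∃ j, ∀ j', IsFrac y i j' → j' = j := by
      by_cases hne : ∃ j, IsFrac y i j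
      · obtain ⟨j, hj⟩ := hne
        exact ⟨j, fun j' hj' => (Set.ncard_le_one (Set.toFinite _)).1 (Nat.le_of_lt_succ hdeg)
          j' hj' j hj⟩
      -- With no fractional edge, any query serves as the last one.
      · exact ⟨⟨0, hn⟩, fun j' hj' => absurd ⟨j', hj'⟩ hne⟩
    refine le_trans ?_ (h.expect_of_single_edge i j hj)
    have ha : 0 ≤ I.otherPayment y i j :=
      Finset.sum_nonneg fun j' _ => mul_nonneg (hy.1 i j').1 (I.bid_nonneg i j')
    rw [I.payment_eq_otherPayment_add y i j] at hi ⊢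
    exact one_sub_mul_le_of_last_edge ha (I.bid_nonneg i j) (hy.1 i j).1
      (I.budget_pos i) (hε j) hi
  induction h with
  | done X =>
    refine single _ _ (.done X) hy hi ?_
    have : {j | IsFrac X.toFrac i j} = ∅ := by
      ext j
      simp only [Set.mem_ofPred_eq, Set.mem_empty_iff_false, iff_false]
      rintro ⟨h0, h1⟩
      by_cases hX : X i j <;> simp [Alloc.toFrac, hX] at h0 h1
    simp [advDegree, this]
  | move y μ K hμ hK ih =>
    rcases lt_or_ge (advDegree y i) 2 with hdeg | hdeg
    · exact single _ _ (.move y μ K hμ hK) hy hi hdeg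
    -- The kept system is that of the point before the move, so the budget still holds if this very
    -- move lowers the degree below two.
    have hpay : ∀ y' ∈ μ.support, I.payment y' i ≤ I.budget i := fun y' hy' =>
      (hμ.mem_support_step hy').keeps.2.2.2 i hdeg
    have hall : ∀ y' ∈ μ.support, (1 - ε / 4) * I.payment y' i ≤
        (K y').expect fun X => min (I.payment X.toFrac i) (I.budget i) := fun y' hy' =>
      ih y' hy' (hμ.mem_support_step hy').keeps_self (hpay y' hy')
    rcases hμ.deterministic_or_mean with ⟨y', rfl, hp⟩ | ⟨p, y₁, y₂, h0, h1, rfl, hm⟩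
    · rw [PMF.pure_bind, ← hp i]
      exact hall y' (by simp)
    · rw [PMF.mix_bind, PMF.pure_bind, PMF.pure_bind, PMF.expect_mix h0.le h1.le]
      have i1 := mul_le_mul_of_nonneg_left
        (hall y₁ (PMF.mem_support_mix_left h0 (by simp))) h0.le
      have i2 := mul_le_mul_of_nonneg_left
        (hall y₂ (PMF.mem_support_mix_right h1 (by simp))) (sub_nonneg.2 h1.le)
      have : I.payment y i = p * I.payment y₁ i + (1 - p) * I.payment y₂ i := by
        conv_lhs => rw [hm]
        simp only [payment, Finset.mul_sum, ← Finset.sum_add_distrib]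
        refine Finset.sum_congr rfl fun j _ => ?_
        simp only [Pi.add_apply, Pi.smul_apply, smul_eq_mul]
        ring
      rw [this]
      linarith

theorem IsLPOptimal.lpOpt_eq {y : Frac m n} (h : I.IsLPOptimal y) : I.lpOpt = I.lpValue y := by
  refine IsGreatest.csSup_eq ⟨⟨y, h.1, rfl⟩, ?_⟩
  rintro _ ⟨x, hx, rfl⟩
  exact h.2 x hx

theorem Rounds.expect_revenue {y : Frac m n} {D : PMF (Alloc m n)} (h : I.Rounds y D)
    (hy : I.IsLPOptimal y) {ε : ℝ} (hε : ∀ i j, I.bid i j ≤ ε * I.budget i) :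
    (4 - ε) / 4 * I.lpOpt ≤ D.expect I.revenue := by
  have hrev : D.expect I.revenue =
      ∑ i, D.expect fun X => min (I.payment X.toFrac i) (I.budget i) :=
    PMF.expect_sum _ D _
  rw [hy.lpOpt_eq, hrev, lpValue, Finset.mul_sum]
  refine Finset.sum_le_sum fun i _ => ?_
  have := h.expect_advertiser hy.1.keeps (hy.1.2.2.2 i) (hε i)
  calc (4 - ε) / 4 * I.payment y i = (1 - ε / 4) * I.payment y i := by ring
    _ ≤ _ := this

theorem bid_le_maxBidRatio_mul (I : AdCell m n s) (i : Fin m) (j : Fin n) :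
    I.bid i j ≤ I.maxBidRatio * I.budget i := by
  rw [← div_le_iff₀ (I.budget_pos i)]
  exact (le_ciSup (f := fun j => I.bid i j / I.budget i) (Set.finite_range _).bddAbove j).trans
    (le_ciSup (f := fun i => ⨆ j, I.bid i j / I.budget i) (Set.finite_range _).bddAbove i)

/-! ### The linear program bounds the integer program -/

theorem lpValue_le_sum_budget {x : Frac m n} (h : I.LPFeasible x) :
    I.lpValue x ≤ ∑ i, I.budget i :=
  Finset.sum_le_sum fun i _ => h.2.2.2 i

theorem lpValue_le_lpOpt {x : Frac m n} (h : I.LPFeasible x) : I.lpValue x ≤ I.lpOpt := by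
  refine le_csSup ⟨∑ i, I.budget i, ?_⟩ ⟨x, h, rfl⟩
  rintro _ ⟨x, hx, rfl⟩
  exact lpValue_le_sum_budget hx

theorem toFrac_nonneg (X : Alloc m n) (i : Fin m) (j : Fin n) : 0 ≤ X.toFrac i j := by
  unfold Alloc.toFrac
  split_ifs <;> simp

theorem toFrac_le_one (X : Alloc m n) (i : Fin m) (j : Fin n) : X.toFrac i j ≤ 1 := by
  unfold Alloc.toFrac
  split_ifs <;> simp

/-- Scaling each advertiser's row down until its payment equals the capped payment yields a feasible
point of the linear program whose value is the revenue. -/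
theorem revenue_le_lpOpt {X : Alloc m n} (h : I.Feasible X) : I.revenue X ≤ I.lpOpt := by
  let θ : Fin m → ℝ := fun i => min 1 (I.budget i / I.payment X.toFrac i)
  have hpay : ∀ i, 0 ≤ I.payment X.toFrac i := fun i =>
    Finset.sum_nonneg fun j _ => mul_nonneg (toFrac_nonneg X i j) (I.bid_nonneg i j)
  have hθ0 : ∀ i, 0 ≤ θ i := fun i =>
    le_min zero_le_one (div_nonneg (I.budget_pos i).le (hpay i))
  have hθ1 : ∀ i, θ i ≤ 1 := fun i => min_le_left _ _
  let x : Frac m n := fun i j => θ i * X.toFrac i j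
  have hxX : ∀ i j, x i j ≤ X.toFrac i j := fun i j =>
    mul_le_of_le_one_left (toFrac_nonneg X i j) (hθ1 i)
  have hq : ∀ j, queryLoad x j ≤ queryLoad X.toFrac j := fun j =>
    Finset.sum_le_sum fun i _ => hxX i j
  have hp : ∀ i, I.payment x i = θ i * I.payment X.toFrac i := fun i => by
    simp only [payment, Finset.mul_sum, x, mul_assoc]
  have hmin : ∀ i, θ i * I.payment X.toFrac i = min (I.payment X.toFrac i) (I.budget i) := by
    intro i
    -- For payment `0` the division makes `θ i` equal to `0`, which is harmless.
    rcases (hpay i).eq_or_lt with h0 | h0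
    · rw [← h0, mul_zero, min_eq_left (I.budget_pos i).le]
    · rw [min_mul_of_nonneg _ _ h0.le, one_mul, div_mul_cancel₀ _ h0.ne']
  have hx : I.LPFeasible x := by
    refine ⟨fun i j => ⟨mul_nonneg (hθ0 i) (toFrac_nonneg X i j),
      (hxX i j).trans (toFrac_le_one X i j)⟩, fun j => (hq j).trans (h.1 j), fun k => ?_,
      fun i => ?_⟩
    · exact (Finset.sum_le_sum fun j _ => hq j).trans (h.2 k)
    · rw [hp, hmin]
      exact min_le_right _ _
  refine le_trans (le_of_eq ?_) (lpValue_le_lpOpt hx)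
  exact Finset.sum_congr rfl fun i _ => by rw [hp, hmin]

/-- If some assigned bid exceeds the budget, the cap binds before and after truncation. Otherwise no
assigned bid changes. -/
theorem truncate_revenue (I : AdCell m n s) (X : Alloc m n) :
    I.truncate.revenue X = I.revenue X := by
  refine Finset.sum_congr rfl fun i _ => ?_
  have hle : I.truncate.payment X.toFrac i ≤ I.payment X.toFrac i :=
    Finset.sum_le_sum fun j _ => mul_le_mul_of_nonneg_left (min_le_left _ _) (toFrac_nonneg X i j)
  change min (I.truncate.payment X.toFrac i) (I.budget i) = _
  by_cases h : ∃ j, X i j = true ∧ I.budget i < I.bid i j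
  · obtain ⟨j, hX, hj⟩ := h
    have : I.budget i ≤ I.truncate.payment X.toFrac i := by
      refine le_trans (le_of_eq ?_) (Finset.single_le_sum
        (f := fun j => X.toFrac i j * I.truncate.bid i j)
        (fun j _ => mul_nonneg (toFrac_nonneg X i j) (I.truncate.bid_nonneg i j))
        (Finset.mem_univ j))
      simp [Alloc.toFrac, hX, truncate, hj.le]
    rw [min_eq_right this, min_eq_right (this.trans hle)]
  · push Not at h
    congr 1
    refine Finset.sum_congr rfl fun j _ => ?_
    by_cases hX : X i j
    · simp [truncate, h j hX]
    · simp [Alloc.toFrac, hX]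

end AdCell

/-! ### Programming with computation trees

A *world* `ω : Ω` is an input of the computation, with register contents `inp ω`. Along a branch of
a computation tree one knows that the world belongs to some set `S`, and one has computed some
*quantities*, which are functions on the worlds. -/

namespace CompTree

variable {Ω R Out : Type} {inp : Ω → R → ℝ} {S S' : Set Ω} {K K' : Set (Ω → ℝ)} {t t' : ℕ}
  {G G' : Ω → PMF Out → Prop}

/-- The quantity `q` is in an input register or in one of the first `N` work registers. -/
def Stored (inp : Ω → R → ℝ) (S : Set Ω) (W : Ω → ℕ → ℝ) (N : ℕ) (q : Ω → ℝ) : Prop :=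
  ∃ r : R ⊕ ℕ, (∀ k, r = .inr k → k < N) ∧ ∀ ω ∈ S, Sum.elim (inp ω) (W ω) r = q ω

/-- Whatever the registers that hold the quantities in `K`, a computation tree of time at most `t`
has on every input in `S` an output law as demanded by `G`. -/
def Solvable (inp : Ω → R → ℝ) (S : Set Ω) (K : Set (Ω → ℝ)) (t : ℕ) (G : Ω → PMF Out → Prop) :
    Prop :=
  ∀ (W : Ω → ℕ → ℝ) (N : ℕ), (∀ q ∈ K, Stored inp S W N q) →
    ∃ T : CompTree R Out, T.time ≤ t ∧ ∀ ω ∈ S, G ω (T.runFrom (inp ω) (W ω))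

theorem Stored.update {W : Ω → ℕ → ℝ} {N : ℕ} {q : Ω → ℝ} (h : Stored inp S W N q)
    (x : Ω → ℝ) : Stored inp S (fun ω => Function.update (W ω) N (x ω)) (N + 1) q := by
  obtain ⟨r, hr, hq⟩ := h
  refine ⟨r, fun k hk => (hr k hk).trans (Nat.lt_succ_self N), fun ω hω => ?_⟩
  rw [← hq ω hω]
  rcases r with r | k
  · rfl
  · simp [Function.update_of_ne (hr k rfl).ne]

theorem stored_update_self (W : Ω → ℕ → ℝ) (N : ℕ) {q x : Ω → ℝ} (h : ∀ ω ∈ S, x ω = q ω) :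
    Stored inp S (fun ω => Function.update (W ω) N (x ω)) (N + 1) q :=
  ⟨.inr N, fun k hk => by cases hk; exact Nat.lt_succ_self N, fun ω hω => by simp [h ω hω]⟩

namespace Solvable

theorem mono_time (h : Solvable inp S K t G) (htt' : t ≤ t') : Solvable inp S K t' G :=
  fun W N hK => let ⟨T, hT, hG⟩ := h W N hK; ⟨T, hT.trans htt', hG⟩

theorem mono_known (h : Solvable inp S K t G) (hKK' : K ⊆ K') : Solvable inp S K' t G :=
  fun W N hK => h W N fun q hq => hK q (hKK' hq)

theorem mono_goal (h : Solvable inp S K t G) (hG : ∀ ω ∈ S, ∀ D, G ω D → G' ω D) :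
    Solvable inp S K t G' :=
  fun W N hK => let ⟨T, hT, hT'⟩ := h W N hK; ⟨T, hT, fun ω hω => hG ω hω _ (hT' ω hω)⟩

theorem output (o : Out) (h : ∀ ω ∈ S, G ω (PMF.pure o)) : Solvable inp S K t G :=
  fun _ _ _ => ⟨.output o, Nat.zero_le _, h⟩

/-- A sample world allows combinatorial choices to be made once for a branch. On an impossible
branch any output will do. -/
theorem of_nonempty [Nonempty Out] (h : ∀ ω₀ ∈ S, Solvable inp S K t G) :
    Solvable inp S K t G := by
  rcases S.eq_empty_or_nonempty with rfl | ⟨ω₀, h₀⟩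
  · exact output (Classical.arbitrary Out) (by simp)
  · exact h ω₀ h₀

theorem union_inputs (h : Solvable inp S (K ∪ Set.range fun r ω => inp ω r) t G) :
    Solvable inp S K t G := by
  intro W N hK
  refine h W N fun q hq => ?_
  rcases hq with hq | ⟨r, rfl⟩
  · exact hK q hq
  · exact ⟨.inl r, by simp, fun _ _ => rfl⟩

theorem insert_one (h : Solvable inp S (insert (fun _ => 1) K) t G) :
    Solvable inp S K (t + 1) G := by
  intro W N hK
  obtain ⟨T, hT, hG⟩ := h (fun ω => Function.update (W ω) N 1) (N + 1) fun q hq => by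
    rcases Set.mem_insert_iff.1 hq with rfl | hq
    · exact stored_update_self W N (x := fun _ => 1) fun _ _ => rfl
    · exact (hK q hq).update _
  exact ⟨.one N T, Nat.succ_le_succ hT, hG⟩

theorem insert_arith (o : ArithOp) {a b : Ω → ℝ} (ha : a ∈ K) (hb : b ∈ K)
    (h : Solvable inp S (insert (fun ω => o.eval (a ω) (b ω)) K) t G) :
    Solvable inp S K (t + 1) G := by
  intro W N hK
  obtain ⟨ra, -, hra⟩ := hK a ha
  obtain ⟨rb, -, hrb⟩ := hK b hb
  obtain ⟨T, hT, hG⟩ := h (fun ω => Function.update (W ω) N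
      (o.eval (Sum.elim (inp ω) (W ω) ra) (Sum.elim (inp ω) (W ω) rb))) (N + 1) fun q hq => by
    rcases Set.mem_insert_iff.1 hq with rfl | hq
    · exact stored_update_self W N (x := fun ω => o.eval (Sum.elim (inp ω) (W ω) ra)
        (Sum.elim (inp ω) (W ω) rb)) fun ω hω => by simp only [hra ω hω, hrb ω hω]
    · exact (hK q hq).update _
  exact ⟨.arith N o ra rb T, Nat.succ_le_succ hT, hG⟩

theorem branch {a b : Ω → ℝ} (ha : a ∈ K) (hb : b ∈ K)
    (hle : Solvable inp {ω ∈ S | a ω ≤ b ω} K t G)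
    (hgt : Solvable inp {ω ∈ S | ¬ a ω ≤ b ω} K t G) : Solvable inp S K (t + 1) G := by
  intro W N hK
  obtain ⟨ra, -, hra⟩ := hK a ha
  obtain ⟨rb, -, hrb⟩ := hK b hb
  have hsub : ∀ S' ⊆ S, ∀ q ∈ K, Stored inp S' W N q := fun S' hS' q hq =>
    let ⟨r, hr, hq⟩ := hK q hq; ⟨r, hr, fun ω hω => hq ω (hS' hω)⟩
  obtain ⟨T₁, ht₁, h₁⟩ := hle W N (hsub _ fun _ h => h.1)
  obtain ⟨T₂, ht₂, h₂⟩ := hgt W N (hsub _ fun _ h => h.1)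
  refine ⟨.branch ra rb T₁ T₂, Nat.succ_le_succ (max_le ht₁ ht₂), fun ω hω => ?_⟩
  simp only [runFrom, hra ω hω, hrb ω hω]
  split_ifs with hc
  · exact h₁ ω ⟨hω, hc⟩
  · exact h₂ ω ⟨hω, hc⟩

theorem coin {p : Ω → ℝ} (hp : p ∈ K) {G₁ G₂ : Ω → PMF Out → Prop}
    (h₁ : Solvable inp S K t G₁) (h₂ : Solvable inp S K t G₂)
    (h : ∀ ω ∈ S, ∀ D₁ D₂, G₁ ω D₁ → G₂ ω D₂ → G ω (PMF.mix (p ω) D₁ D₂)) :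
    Solvable inp S K (t + 1) G := by
  intro W N hK
  obtain ⟨r, -, hr⟩ := hK p hp
  obtain ⟨T₁, ht₁, h₁⟩ := h₁ W N hK
  obtain ⟨T₂, ht₂, h₂⟩ := h₂ W N hK
  refine ⟨.coin r T₁ T₂, Nat.succ_le_succ (max_le ht₁ ht₂), fun ω hω => ?_⟩
  simp only [runFrom, hr ω hω]
  exact h ω hω _ _ (h₁ ω hω) (h₂ ω hω)

end Solvable

/-! ### Evaluation of arithmetic expressions -/

/-- The quantity `q` is the value of an arithmetic expression of size at most `c` in the quantities
of `K`. -/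
inductive Cost (K : Set (Ω → ℝ)) : (Ω → ℝ) → ℕ → Prop
  | mem {q : Ω → ℝ} : q ∈ K → Cost K q 0
  | op (o : ArithOp) {a b : Ω → ℝ} {c d : ℕ} : Cost K a c → Cost K b d →
      Cost K (fun ω => o.eval (a ω) (b ω)) (c + d + 1)
  | weaken {q : Ω → ℝ} {c d : ℕ} : Cost K q c → c ≤ d → Cost K q d

namespace Cost

variable {a b : Ω → ℝ} {c d : ℕ}

theorem mono {q : Ω → ℝ} (h : Cost K q c) (hK : K ⊆ K') : Cost K' q c := by
  induction h with
  | mem h => exact .mem (hK h)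
  | op o _ _ iha ihb => exact .op o iha ihb
  | weaken _ hcd ih => exact .weaken ih hcd

theorem add (ha : Cost K a c) (hb : Cost K b d) : Cost K (fun ω => a ω + b ω) (c + d + 1) :=
  .op .add ha hb

theorem sub (ha : Cost K a c) (hb : Cost K b d) : Cost K (fun ω => a ω - b ω) (c + d + 1) :=
  .op .sub ha hb

theorem mul (ha : Cost K a c) (hb : Cost K b d) : Cost K (fun ω => a ω * b ω) (c + d + 1) :=
  .op .mul ha hb

theorem div (ha : Cost K a c) (hb : Cost K b d) : Cost K (fun ω => a ω / b ω) (c + d + 1) :=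
  .op .div ha hb

theorem neg (h0 : (fun _ => 0) ∈ K) (ha : Cost K a c) : Cost K (fun ω => -a ω) (c + 1) := by
  have := (Cost.mem h0).sub ha
  simpa only [zero_sub, zero_add] using this

theorem sum {ι : Type*} (t : Finset ι) {f : ι → Ω → ℝ} (h0 : (fun _ => 0) ∈ K)
    (h : ∀ i ∈ t, Cost K (f i) c) : Cost K (fun ω => ∑ i ∈ t, f i ω) (t.card * (c + 1)) := by
  classical
  induction t using Finset.induction_on with
  | empty => simpa using Cost.mem h0
  | insert i t hi ih =>
    have h1 := (h i (Finset.mem_insert_self i t)).add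
      (ih fun i' hi' => h i' (Finset.mem_insert_of_mem hi'))
    rw [Finset.card_insert_of_notMem hi]
    have : (t.card + 1) * (c + 1) = c + t.card * (c + 1) + 1 := by ring
    rw [this]
    simpa only [Finset.sum_insert hi] using h1

end Cost

namespace Solvable

theorem insert_cost {q : Ω → ℝ} {c : ℕ} (hq : Cost K q c)
    (h : Solvable inp S (insert q K) t G) : Solvable inp S K (t + c) G := by
  -- The known set must be allowed to grow, because the second operand is computed when the first is
  -- already stored.
  suffices key : ∀ q c, Cost K q c → ∀ K' ⊇ K, ∀ t, Solvable inp S (insert q K') t G →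
      Solvable inp S K' (t + c) G from key q c hq K subset_rfl t h
  intro q c hq
  induction hq with
  | mem hq => exact fun K' hK t h => h.mono_known (Set.insert_subset (hK hq) subset_rfl)
  | @op o a b c d _ _ iha ihb =>
    intro K' hK t h
    have h1 : Solvable inp S (insert b (insert a K')) (t + 1) G := by
      refine insert_arith o (a := a) (b := b) (by simp) (by simp) (h.mono_known ?_)
      exact Set.insert_subset_insert ((Set.subset_insert _ _).trans (Set.subset_insert _ _))
    have h2 := ihb (insert a K') (hK.trans (Set.subset_insert _ _)) _ h1
    have h3 := iha K' hK _ h2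
    exact h3.mono_time (by omega)
  | weaken _ hcd ih => exact fun K' hK t h => (ih K' hK t h).mono_time (by omega)

theorem union_range {ι : Type*} [Fintype ι] {q : ι → Ω → ℝ} {c : ℕ} (hq : ∀ i, Cost K (q i) c)
    (h : Solvable inp S (K ∪ Set.range q) t G) :
    Solvable inp S K (t + Fintype.card ι * c) G := by
  classical
  suffices key : ∀ A : Finset ι, Solvable inp S (K ∪ q '' ↑A) t G →
      Solvable inp S K (t + A.card * c) G from
    key Finset.univ (by simpa using h)
  clear h
  intro A
  induction A using Finset.induction_on generalizing t with
  | empty => intro h; simpa using h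
  | insert i A hi ih =>
    intro h
    rw [Finset.coe_insert, Set.image_insert_eq, Set.union_insert] at h
    have := ih (insert_cost ((hq i).mono Set.subset_union_left) h)
    refine this.mono_time ?_
    rw [Finset.card_insert_of_notMem hi]
    exact (by ring : t + c + A.card * c = t + (A.card + 1) * c).le

/-- Make finitely many comparisons. -/
theorem decide {ι : Type*} [Fintype ι] {a b : ι → Ω → ℝ} (ha : ∀ i, a i ∈ K) (hb : ∀ i, b i ∈ K)
    (h : ∀ σ : ι → Prop, Solvable inp {ω ∈ S | ∀ i, a i ω ≤ b i ω ↔ σ i} K t G) :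
    Solvable inp S K (t + Fintype.card ι) G := by
  classical
  -- Each comparison leaves the others to be made on a smaller set of worlds, hence the
  -- quantification over `S`.
  suffices key : ∀ (A : Finset ι) (S : Set Ω) (t : ℕ),
      (∀ σ : ι → Prop, Solvable inp {ω ∈ S | ∀ i ∈ A, a i ω ≤ b i ω ↔ σ i} K t G) →
      Solvable inp S K (t + A.card) G from
    key Finset.univ S t (by simpa using h)
  intro A
  induction A using Finset.induction_on with
  | empty => intro S t h; simpa using h fun _ => True
  | insert i A hi ih =>
    intro S t h
    rw [Finset.card_insert_of_notMem hi, ← add_assoc]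
    have hne : ∀ i' ∈ A, i' ≠ i := fun i' h' e => hi (e ▸ h')
    refine branch (ha i) (hb i) (ih _ t fun σ => ?_) (ih _ t fun σ => ?_)
    · convert h (Function.update σ i True) using 1
      ext ω
      simp +contextual only [Set.mem_ofPred_eq, Finset.mem_insert, forall_eq_or_imp,
        Function.update_self, iff_true, and_assoc, and_congr_right_iff]
      intro _ _
      exact forall₂_congr fun l hl => by rw [Function.update_of_ne (hne l hl)]
    · convert h (Function.update σ i False) using 1
      ext ω
      simp +contextual only [Set.mem_ofPred_eq, Finset.mem_insert, forall_eq_or_imp,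
        Function.update_self, iff_false, and_assoc, and_congr_right_iff]
      intro _ _
      exact forall₂_congr fun l hl => by rw [Function.update_of_ne (hne l hl)]

/-! ### Gaussian elimination and the ratio test -/

/-- Gaussian elimination: compute a nonzero solution, supported on `F`, of fewer than `F.card`
homogeneous linear equations. -/
theorem kernel [Nonempty Out] {E V : Type} [Fintype E] [Fintype V] (C : Finset V) :
    ∀ {S : Set Ω} {K : Set (Ω → ℝ)} {t : ℕ} (F : Finset E) {A : V → E → Ω → ℝ},
      C.card < F.card → (fun _ => 0) ∈ K → (fun _ => 1) ∈ K → (∀ v e, A v e ∈ K) →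
      (∀ S' ⊆ S, ∀ z : E → Ω → ℝ,
        (∀ ω ∈ S', (∀ e ∉ F, z e ω = 0) ∧ (∃ e, z e ω ≠ 0) ∧ ∀ v ∈ C, ∑ e, A v e ω * z e ω = 0) →
        Solvable inp S' (K ∪ Set.range z) t G) →
      Solvable inp S K (t + C.card * (3 * (Fintype.card V * Fintype.card E) +
        4 * Fintype.card E + 2)) G := by
  classical
  induction C using Finset.induction_on with
  | empty =>
    intro S K t F A hF h0 h1 hA h
    obtain ⟨e₀, he₀⟩ := Finset.card_pos.1 hF
    -- With no equations left, a unit vector in `F` is a solution.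
    have := h S subset_rfl (fun e _ => if e = e₀ then 1 else 0) fun ω _ =>
      ⟨fun e he => if_neg fun h : e = e₀ => he (h ▸ he₀), ⟨e₀, by simp⟩, by simp⟩
    refine (this.mono_known ?_).mono_time (Nat.le_add_right _ _)
    refine Set.union_subset subset_rfl ?_
    rintro _ ⟨e, rfl⟩
    by_cases he : e = e₀
    · simpa [he] using h1
    · simpa [he] using h0
  | insert v C hv ih =>
    intro S K t F A hF h0 h1 hA h
    rw [Finset.card_insert_of_notMem hv] at hF ⊢
    -- Comparing each entry of row `v` with `0` in both directions makes its zero pattern constant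
    -- on the branch, so one pivot serves all its worlds.
    have key : ∀ σ : E ⊕ E → Prop, Solvable inp
        {ω ∈ S | ∀ i : E ⊕ E, (Sum.elim (A v) (fun _ _ => 0) i ω ≤
          Sum.elim (fun _ _ => 0) (A v) i ω ↔ σ i)} K
        (t + C.card * (3 * (Fintype.card V * Fintype.card E) + 4 * Fintype.card E + 2) +
          (3 * (Fintype.card V * Fintype.card E) + 2 * Fintype.card E + 2)) G := by
      intro σ
      refine of_nonempty fun ω₀ hω₀ => ?_
      have hσ : ∀ ω ∈ {ω ∈ S | ∀ i : E ⊕ E, (Sum.elim (A v) (fun _ _ => 0) i ω ≤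
          Sum.elim (fun _ _ => 0) (A v) i ω ↔ σ i)}, ∀ e, A v e ω = 0 ↔ A v e ω₀ = 0 := by
        intro ω hω e
        have a1 := (hω.2 (.inl e)).trans (hω₀.2 (.inl e)).symm
        have a2 := (hω.2 (.inr e)).trans (hω₀.2 (.inr e)).symm
        simp only [Sum.elim_inl, Sum.elim_inr] at a1 a2
        rw [le_antisymm_iff, le_antisymm_iff, a1, a2]
      revert hσ hω₀
      generalize hS₁ : {ω ∈ S | ∀ i : E ⊕ E, (Sum.elim (A v) (fun _ _ => 0) i ω ≤
          Sum.elim (fun _ _ => 0) (A v) i ω ↔ σ i)} = S₁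
      have hS₁S : S₁ ⊆ S := hS₁ ▸ fun ω hω => hω.1
      intro hω₀ hσ
      -- If row `v` vanishes on `F`, its equation is automatic. Otherwise a pivot uses up one
      -- equation and one unknown.
      by_cases hz : ∀ e ∈ F, A v e ω₀ = 0
      · refine (ih F (by omega) h0 h1 hA fun S' hS' z hz' => h S' (hS'.trans hS₁S) z
          fun ω hω => ?_).mono_time (Nat.le_add_right _ _)
        obtain ⟨b1, b2, b3⟩ := hz' ω hω
        refine ⟨b1, b2, fun u hu => ?_⟩
        rcases Finset.mem_insert.1 hu with rfl | hu
        · refine Finset.sum_eq_zero fun e _ => ?_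
          by_cases he : e ∈ F
          · rw [(hσ ω (hS' hω) e).2 (hz e he), zero_mul]
          · rw [b1 e he, mul_zero]
        · exact b3 u hu
      · push Not at hz
        obtain ⟨p, hpF, hp₀⟩ := hz
        have hp : ∀ ω ∈ S₁, A v p ω ≠ 0 := fun ω hω h0 => hp₀ ((hσ ω hω p).1 h0)
        -- Subtracting multiples of row `v` clears column `p` from every equation.
        let A' : V × E → Ω → ℝ := fun ue ω => A ue.1 ue.2 ω - A ue.1 p ω * A v ue.2 ω / A v p ω
        have hA' : ∀ ue, Cost K (A' ue) 3 := fun ue =>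
          (Cost.mem (hA ue.1 ue.2)).sub
            (((Cost.mem (hA ue.1 p)).mul (Cost.mem (hA v ue.2))).div (Cost.mem (hA v p)))
        have step : Solvable inp S₁ (K ∪ Set.range A')
            ((t + (2 * Fintype.card E + 2)) +
              C.card * (3 * (Fintype.card V * Fintype.card E) + 4 * Fintype.card E + 2)) G := by
          refine ih (F.erase p) (A := fun u e => A' (u, e)) ?_ (.inl h0) (.inl h1)
            (fun u e => .inr ⟨(u, e), rfl⟩) fun S' hS' z hz => ?_
          · rw [Finset.card_erase_of_mem hpF]
            omega
          -- Back substitution: the recursive solution vanishes at `p`, and equation `v` determines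
          -- the value to put there.
          · let zp : Ω → ℝ := fun ω => -(∑ e, A v e ω * z e ω) / A v p ω
            have hzp : Cost ((K ∪ Set.range A') ∪ Set.range z) zp (2 * Fintype.card E + 2) := by
              have hs : Cost ((K ∪ Set.range A') ∪ Set.range z)
                  (fun ω => ∑ e, A v e ω * z e ω) (Fintype.card E * (0 + 0 + 1 + 1)) :=
                Cost.sum Finset.univ (.inl (.inl h0)) fun e _ =>
                  (Cost.mem (.inl (.inl (hA v e)))).mul (Cost.mem (.inr ⟨e, rfl⟩))
              have := (hs.neg (.inl (.inl h0))).div (Cost.mem (.inl (.inl (hA v p))))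
              convert this using 1
              ring
            refine insert_cost hzp ?_
            have hsol : ∀ ω ∈ S', (∀ e ∉ F, Function.update z p zp e ω = 0) ∧
                (∃ e, Function.update z p zp e ω ≠ 0) ∧ ∀ u ∈ insert v C,
                  ∑ e, A u e ω * Function.update z p zp e ω = 0 := by
              intro ω hω
              obtain ⟨b1, ⟨e₁, he₁⟩, b3⟩ := hz ω hω
              have hzp0 : z p ω = 0 := b1 p (Finset.notMem_erase p F)
              have hsplit : ∀ u, ∑ e, A u e ω * Function.update z p zp e ω =
                  A u p ω * zp ω + ∑ e, A u e ω * z e ω := by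
                intro u
                rw [← Finset.add_sum_erase Finset.univ
                    (fun e => A u e ω * Function.update z p zp e ω) (Finset.mem_univ p),
                  ← Finset.add_sum_erase Finset.univ
                    (fun e => A u e ω * z e ω) (Finset.mem_univ p), hzp0, mul_zero, zero_add,
                  Function.update_self]
                congr 1
                refine Finset.sum_congr rfl fun e he => ?_
                rw [Function.update_of_ne (Finset.ne_of_mem_erase he)]
              refine ⟨fun e he => ?_, ⟨e₁, ?_⟩, fun u hu => ?_⟩
              · have hne : e ≠ p := fun h => he (h ▸ hpF)
                rw [Function.update_of_ne hne]
                exact b1 e fun h => he (Finset.mem_of_mem_erase h)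
              · have hne : e₁ ≠ p := fun h => he₁ (h ▸ hzp0)
                rwa [Function.update_of_ne hne]
              · rw [hsplit]
                have hpω := hp ω (hS' hω)
                rcases Finset.mem_insert.1 hu with rfl | hu
                · simp only [zp]
                  field_simp
                  ring
                · have h3 := b3 u hu
                  simp only [A', sub_mul, Finset.sum_sub_distrib] at h3
                  have h4 : ∑ e, A u p ω * A v e ω / A v p ω * z e ω =
                      A u p ω * (∑ e, A v e ω * z e ω) / A v p ω := by
                    rw [Finset.mul_sum, Finset.sum_div]
                    exact Finset.sum_congr rfl fun e _ => by ring
                  rw [h4] at h3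
                  simp only [zp]
                  rw [← h3]
                  ring
            refine (h S' (hS'.trans hS₁S) (Function.update z p zp) hsol).mono_known ?_
            refine Set.union_subset (fun q hq => .inr (.inl (.inl hq))) ?_
            rintro _ ⟨e, rfl⟩
            by_cases he : e = p
            · subst he
              rw [Function.update_self]
              exact Set.mem_insert _ _
            · rw [Function.update_of_ne he]
              exact .inr (.inr ⟨e, rfl⟩)
        refine (union_range hA' step).mono_time (le_of_eq ?_)
        rw [Fintype.card_prod]
        ring
    refine (decide (ι := E ⊕ E) ?_ ?_ key).mono_time (le_of_eq ?_)
    · rintro (e | e)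
      · exact hA v e
      · exact h0
    · rintro (e | e)
      · exact h0
      · exact hA v e
    · rw [Fintype.card_sum]
      ring

/-- The ratio test: compute the least of the quotients `a c / b c` with `b c > 0`. -/
theorem ratioTest [Nonempty Out] {Q : Type} [Fintype Q] {a b : Q → Ω → ℝ} (act : Q → Prop)
    (h0 : (fun _ => 0) ∈ K) (ha : ∀ c, a c ∈ K) (hb : ∀ c, b c ∈ K)
    (hex : ∀ ω ∈ S, ∃ c, act c ∧ 0 < b c ω)
    (h : ∀ S' ⊆ S, ∀ α : Ω → ℝ, (∀ ω ∈ S', ∃ c₀, act c₀ ∧ 0 < b c₀ ω ∧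
        α ω = a c₀ ω / b c₀ ω ∧ ∀ c, act c → 0 < b c ω → α ω ≤ a c ω / b c ω) →
      Solvable inp S' (insert α K) t G) :
    Solvable inp S K (t + (Fintype.card Q * Fintype.card Q + 2 * Fintype.card Q)) G := by
  classical
  let q : Q → Ω → ℝ := fun c ω => a c ω / b c ω
  have hq : ∀ c, Cost K (q c) 1 := fun c => (Cost.mem (ha c)).div (Cost.mem (hb c))
  -- Once all quotients are compared pairwise and all signs are known, a minimizer for one world is
  -- a minimizer for every world of the branch. Quotients with zero denominator are computed but
  -- never selected.
  have key : Solvable inp S (K ∪ Set.range q) (t + Fintype.card ((Q × Q) ⊕ Q)) G := by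
    refine decide (a := Sum.elim (fun cc => q cc.1) b)
      (b := Sum.elim (fun cc => q cc.2) fun _ _ => 0) ?_ ?_ fun σ => ?_
    · rintro (cc | c)
      · exact .inr ⟨cc.1, rfl⟩
      · exact .inl (hb c)
    · rintro (cc | c)
      · exact .inr ⟨cc.2, rfl⟩
      · exact .inl h0
    · refine of_nonempty fun ω₀ hω₀ => ?_
      obtain ⟨c₁, hc₁⟩ := hex ω₀ hω₀.1
      obtain ⟨c₀, hc₀, hmin⟩ := Finset.exists_min_image
        (Finset.univ.filter fun c => act c ∧ 0 < b c ω₀) (fun c => q c ω₀) ⟨c₁, by simpa using hc₁⟩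
      simp only [Finset.mem_filter, Finset.mem_univ, true_and] at hc₀ hmin
      refine (h _ (fun ω hω => hω.1) (q c₀) fun ω hω => ?_).mono_known
        (Set.insert_subset (.inr ⟨c₀, rfl⟩) Set.subset_union_left)
      have hpos : ∀ c, 0 < b c ω ↔ 0 < b c ω₀ := fun c => by
        have := (hω.2 (.inr c)).trans (hω₀.2 (.inr c)).symm
        simpa using not_congr this
      refine ⟨c₀, hc₀.1, (hpos c₀).2 hc₀.2, rfl, fun c hc hbc => ?_⟩
      have := (hω.2 (.inl (c₀, c))).trans (hω₀.2 (.inl (c₀, c))).symm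
      exact this.2 (hmin c ⟨hc, (hpos c).1 hbc⟩)
  refine (union_range hq key).mono_time (le_of_eq ?_)
  simp only [Fintype.card_sum, Fintype.card_prod]
  ring

end Solvable

end CompTree

namespace AdCell

variable {m n s : ℕ}

/-! ### The rounding as a computation tree -/

theorem Rounds.of_pure {I : AdCell m n s} {y y' : Frac m n} {D : PMF (Alloc m n)}
    (h : I.Move y (PMF.pure y')) (h' : I.Rounds y' D) : I.Rounds y D := by
  have := Rounds.move y _ (fun _ => D) h (by simpa using h')
  simpa using this

/-- The continuation in `Rounds` is a function of the next solution, so the two outcomes must differ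
in order to be continued by separate laws. -/
theorem Rounds.of_mix {I : AdCell m n s} {y y₁ y₂ : Frac m n} {p : ℝ} {D₁ D₂ : PMF (Alloc m n)}
    (h : I.Move y (PMF.mix p (PMF.pure y₁) (PMF.pure y₂))) (hne : y₁ ≠ y₂)
    (h₁ : I.Rounds y₁ D₁) (h₂ : I.Rounds y₂ D₂) : I.Rounds y (PMF.mix p D₁ D₂) := by
  classical
  have := Rounds.move y _ (fun y' => if y' = y₁ then D₁ else D₂) h (by
    intro y' hy'
    rcases PMF.mem_support_mix hy' with hy' | hy'
    · obtain rfl : y' = y₁ := by simpa using hy'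
      simpa using h₁
    · obtain rfl : y' = y₂ := by simpa using hy'
      simpa [hne.symm] using h₂)
  rw [PMF.mix_bind, PMF.pure_bind, PMF.pure_bind] at this
  simpa [hne.symm] using this

/-- A nonzero direction eventually leaves the box, so the ratio test has a candidate. -/
theorem exists_slope_pos (I : AdCell m n s) {r : Frac m n} (hr : r ≠ 0) (y : Frac m n) :
    ∃ c, ActiveIneq y c ∧ 0 < I.slope r c := by
  obtain ⟨i, hi⟩ := Function.ne_iff.1 hr
  obtain ⟨j, hij⟩ := Function.ne_iff.1 hi
  rcases lt_or_gt_of_ne hij with h | h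
  · exact ⟨.inl (i, j), trivial, by simpa [slope] using h⟩
  · exact ⟨.inr (.inl (i, j)), trivial, by simpa [slope] using h⟩

theorem slack_pos_of_slope_pos {I : AdCell m n s} {y r : Frac m n} (hr : IsDirection y r)
    (h : I.Allows y r) (c : Ineq m n s) (hc : ActiveIneq y c) (hs : 0 < I.slope r c) :
    0 < I.slack y c := by
  rcases c with e | e | v
  · exact (hr.2 e.1 e.2 (by simp only [slope] at hs; linarith)).1
  · exact sub_pos.2 (hr.2 e.1 e.2 (by simp only [slope] at hs; linarith)).2
  · exact sub_pos.2 (h v hc hs)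

theorem activeIneq_congr {y y' : Frac m n} (h : IsFrac y = IsFrac y') (c : Ineq m n s) :
    ActiveIneq y c ↔ ActiveIneq y' c := by
  rcases c with e | e | i | v <;> simp [ActiveIneq, Active, advDegree, h]

/-- The inputs of the rounding. -/
abbrev World (m n s : ℕ) : Type := AdCell m n s × Frac m n

/-- The contents of the input registers. -/
noncomputable def World.input (ω : World m n s) : InputReg m n s → ℝ := ω.1.input ω.2

/-- The quantities in `K` comprise the input and the constants `0` and `1`. -/
structure Basic (K : Set (World m n s → ℝ)) : Prop where
  zero : (fun _ => 0) ∈ K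
  one : (fun _ => 1) ∈ K
  input : ∀ r, (fun ω => World.input ω r) ∈ K

/-- The entries of `Y` are among the quantities in `K`. -/
def Known (K : Set (World m n s → ℝ)) (Y : World m n s → Frac m n) : Prop :=
  ∀ i j, (fun ω => Y ω i j) ∈ K

variable {S : Set (World m n s)} {K K' : Set (World m n s → ℝ)} {Y Z : World m n s → Frac m n}
  {t : ℕ} {G : World m n s → PMF (Alloc m n) → Prop}

theorem Basic.mono (h : Basic K) (hK : K ⊆ K') : Basic K' :=
  ⟨hK h.zero, hK h.one, fun r => hK (h.input r)⟩

theorem Known.mono (h : Known K Y) (hK : K ⊆ K') : Known K' Y := fun i j => hK (h i j)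

theorem Basic.coef_mem (h : Basic K) (v : Row m n s) (e : Fin m × Fin n) :
    (fun ω : World m n s => ω.1.coef v e) ∈ K := by
  rcases v with i | j | k
  · by_cases he : e.1 = i
    · simpa [coef, he, World.input, AdCell.input] using h.input (.bid i e.2)
    · simpa [coef, he] using h.zero
  · by_cases he : e.2 = j
    · simpa [coef, he] using h.one
    · simpa [coef, he] using h.zero
  · exact h.input (.customer e.2 k)

theorem Basic.bound_mem (h : Basic K) (v : Row m n s) :
    (fun ω : World m n s => ω.1.bound v) ∈ K := by
  rcases v with i | j | k
  · exact h.input (.budget i)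
  · exact h.input (.arrival j)
  · exact h.input (.capacity k)

open CompTree

theorem Known.cost_load (hY : Known K Y) (h : Basic K) (v : Row m n s) :
    Cost K (fun ω => ω.1.load (Y ω) v) (2 * (m * n)) := by
  have : Cost K (fun ω : World m n s => ∑ e : Fin m × Fin n, ω.1.coef v e * Y ω e.1 e.2)
      ((Finset.univ : Finset (Fin m × Fin n)).card * (0 + 0 + 1 + 1)) :=
    Cost.sum Finset.univ h.zero fun e _ =>
      (Cost.mem (h.coef_mem v e)).mul (Cost.mem (hY e.1 e.2))
  simp only [← load_eq_sum, Finset.card_univ, Fintype.card_prod, Fintype.card_fin] at this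
  exact this.weaken (by omega)

theorem Known.cost_slope (hZ : Known K Z) (h : Basic K) (c : Ineq m n s) :
    Cost K (fun ω => ω.1.slope (Z ω) c) (2 * (m * n) + 1) := by
  rcases c with e | e | v
  · exact ((Cost.mem (hZ e.1 e.2)).neg h.zero).weaken (by omega)
  · exact (Cost.mem (hZ e.1 e.2)).weaken (by omega)
  · exact (hZ.cost_load h v).weaken (by omega)

theorem Known.cost_slack (hY : Known K Y) (h : Basic K) (c : Ineq m n s) :
    Cost K (fun ω => ω.1.slack (Y ω) c) (2 * (m * n) + 1) := by
  rcases c with e | e | v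
  · exact (Cost.mem (hY e.1 e.2)).weaken (by omega)
  · exact ((Cost.mem h.one).sub (Cost.mem (hY e.1 e.2))).weaken (by omega)
  · exact ((Cost.mem (h.bound_mem v)).sub (hY.cost_load h v)).weaken (by omega)

/-- The number of all constraints. -/
abbrev numIneq (m n s : ℕ) : ℕ := m * n + (m * n + (m + (n + s)))

/-- The time to compute the length of a maximal step. -/
def maxStepTime (m n s : ℕ) : ℕ :=
  numIneq m n s * numIneq m n s + 2 * numIneq m n s + 2 * (numIneq m n s * (2 * (m * n) + 1))

theorem card_ineq : Fintype.card (Ineq m n s) = numIneq m n s := by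
  simp [numIneq]

/-- Which constraints are active depends only on the fractional edges. Fixing these as `fr` over the
branch lets one ratio test serve all its worlds. -/
theorem solvable_maxStep {fr : Fin m → Fin n → Prop} (hK : Basic K) (hY : Known K Y)
    (hZ : Known K Z)
    (hS : ∀ ω ∈ S, IsFrac (Y ω) = fr ∧ ω.1.Keeps (Y ω) (Y ω) ∧ IsDirection (Y ω) (Z ω) ∧
      ω.1.Allows (Y ω) (Z ω))
    (h : ∀ S' ⊆ S, ∀ α : World m n s → ℝ, (∀ ω ∈ S', ω.1.MaxStep (Y ω) (Z ω) (α ω)) →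
      Solvable World.input S' (insert α K) t G) :
    Solvable World.input S K (t + maxStepTime m n s) G := by
  refine .of_nonempty fun ω₀ hω₀ => ?_
  let a : Ineq m n s → World m n s → ℝ := fun c ω => ω.1.slack (Y ω) c
  let b : Ineq m n s → World m n s → ℝ := fun c ω => ω.1.slope (Z ω) c
  have hact : ∀ ω ∈ S, ∀ c : Ineq m n s, ActiveIneq (Y ω) c ↔ ActiveIneq (Y ω₀) c :=
    fun ω hω c => activeIneq_congr ((hS ω hω).1.trans (hS ω₀ hω₀).1.symm) c
  have key : Solvable World.input S ((K ∪ Set.range a) ∪ Set.range b)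
      (t + (Fintype.card (Ineq m n s) * Fintype.card (Ineq m n s) +
        2 * Fintype.card (Ineq m n s))) G := by
    refine Solvable.ratioTest (a := a) (b := b) (ActiveIneq (Y ω₀)) (.inl (.inl hK.zero))
      (fun c => .inl (.inr ⟨c, rfl⟩)) (fun c => .inr ⟨c, rfl⟩)
      (fun ω hω => ω.1.exists_slope_pos (hS ω hω).2.2.1.1 _) fun S' hS' α hα => ?_
    refine (h S' hS' α fun ω hω => ?_).mono_known (Set.insert_subset_insert
      (Set.subset_union_left.trans Set.subset_union_left))
    obtain ⟨c₀, h1, h2, h3, h4⟩ := hα ω hω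
    obtain ⟨-, g2, g3, g4⟩ := hS ω (hS' hω)
    refine ω.1.maxStep_of_ratio c₀ g2 (slack_pos_of_slope_pos g3 g4)
      ((hact ω (hS' hω) c₀).2 h1) h2 h3 fun c hc => h4 c ((hact ω (hS' hω) c).1 hc)
  have := Solvable.union_range (fun c => hY.cost_slack hK c) (Solvable.union_range
    (fun c => (hZ.mono Set.subset_union_left).cost_slope (hK.mono Set.subset_union_left) c) key)
  refine this.mono_time (le_of_eq ?_)
  rw [card_ineq, maxStepTime]
  ring

theorem solvable_update {f : World m n s → Frac m n} {c : ℕ}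
    (hf : ∀ i j, Cost K (fun ω => f ω i j) c)
    (h : ∀ K' ⊇ K, Known K' f → Solvable World.input S K' t G) :
    Solvable World.input S K (t + m * n * c) G := by
  have := Solvable.union_range (ι := Fin m × Fin n) (q := fun e ω => f ω e.1 e.2)
    (fun e => hf e.1 e.2) (h _ Set.subset_union_left fun i j => .inr ⟨(i, j), rfl⟩)
  simpa using this

/-- Choose the sign of a direction so that a given load does not grow. -/
theorem solvable_sign (v : Row m n s) (hK : Basic K) (hZ : Known K Z)
    (h : ∀ S' ⊆ S, ∀ K' ⊇ K, ∀ Z' : World m n s → Frac m n, Known K' Z' →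
      (∀ ω ∈ S', (Z' ω = Z ω ∨ Z' ω = -Z ω) ∧ ω.1.load (Z' ω) v ≤ 0) →
      Solvable World.input S' K' t G) :
    Solvable World.input S K (t + m * n * 1 + 1 + 2 * (m * n)) G := by
  refine Solvable.insert_cost (hZ.cost_load hK v) ?_
  refine Solvable.branch (a := fun ω => ω.1.load (Z ω) v) (b := fun _ => 0) (Set.mem_insert _ _)
    (.inr hK.zero) ?_ ?_
  · exact (h _ (fun ω hω => hω.1) _ (Set.subset_insert _ _) Z (hZ.mono (Set.subset_insert _ _))
      fun ω hω => ⟨.inl rfl, hω.2⟩).mono_time (by omega)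
  · refine solvable_update (f := fun ω => -Z ω)
      (fun i j => ((Cost.mem (.inr (hZ i j))).neg (.inr hK.zero))) fun K' hK' hf => ?_
    refine h _ (fun ω hω => hω.1) K' ((Set.subset_insert _ _).trans hK') _ hf
      fun ω hω => ⟨.inr rfl, ?_⟩
    rw [load_neg]
    linarith [not_le.1 hω.2]

/-- The computation can go on from every solution of smaller potential. -/
def Continues (m n s p t : ℕ) : Prop :=
  ∀ (S : Set (World m n s)) (K : Set (World m n s → ℝ)) (Y : World m n s → Frac m n), Basic K →
    Known K Y → (∀ ω ∈ S, ω.1.Keeps (Y ω) (Y ω) ∧ ω.1.potential (Y ω) < p) →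
    Solvable World.input S K t fun ω D => ω.1.Rounds (Y ω) D

theorem solvable_deterministic {p : ℕ} (hrec : Continues m n s p t) {fr : Fin m → Fin n → Prop}
    (hK : Basic K) (hY : Known K Y) (hZ : Known K Z)
    (hS : ∀ ω ∈ S, IsFrac (Y ω) = fr ∧ ω.1.Keeps (Y ω) (Y ω) ∧ IsDirection (Y ω) (Z ω) ∧
      ω.1.Allows (Y ω) (Z ω))
    (hp : ∀ ω ∈ S, ω.1.potential (Y ω) < p + 1)
    (hmove : ∀ ω ∈ S, ∀ β, ω.1.MaxStep (Y ω) (Z ω) β →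
      ω.1.Move (Y ω) (PMF.pure (Y ω + β • Z ω))) :
    Solvable World.input S K (t + m * n * 2 + maxStepTime m n s)
      fun ω D => ω.1.Rounds (Y ω) D := by
  refine solvable_maxStep hK hY hZ hS fun S' hS' α hα => ?_
  refine solvable_update (f := fun ω => Y ω + α ω • Z ω)
    (fun i j => (Cost.mem (.inr (hY i j))).add
      ((Cost.mem (Set.mem_insert _ _)).mul (Cost.mem (.inr (hZ i j))))) fun K' hK' hf => ?_
  have hm : ∀ ω ∈ S', ω.1.Move (Y ω) (PMF.pure (Y ω + α ω • Z ω)) := fun ω hω =>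
    hmove ω (hS' hω) _ (hα ω hω)
  refine (hrec S' K' _ (hK.mono ((Set.subset_insert _ _).trans hK')) hf fun ω hω => ?_).mono_goal
    fun ω hω D hD => .of_pure (hm ω hω) hD
  have hs := (hm ω hω).mem_support_step (y' := Y ω + α ω • Z ω) (by simp)
  have := hs.potential_lt
  have := hp ω (hS' hω)
  exact ⟨hs.keeps_self, by omega⟩

/-- Both step lengths, both outcomes and the bias are computed before the toss, and each side
continues by the recursion on the potential. -/
theorem solvable_randMove {p : ℕ} (hrec : Continues m n s p t) {fr : Fin m → Fin n → Prop}
    (hK : Basic K) (hY : Known K Y) (hZ : Known K Z)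
    (hS : ∀ ω ∈ S, IsFrac (Y ω) = fr ∧ ω.1.Keeps (Y ω) (Y ω) ∧ IsDirection (Y ω) (Z ω) ∧
      ω.1.Allows (Y ω) (Z ω) ∧ ω.1.Allows (Y ω) (-Z ω))
    (hp : ∀ ω ∈ S, ω.1.potential (Y ω) < p + 1)
    (hmove : ∀ ω ∈ S, ∀ α β, ω.1.MaxStep (Y ω) (Z ω) α → ω.1.MaxStep (Y ω) (-Z ω) β →
      ω.1.Move (Y ω) (PMF.mix (β / (α + β)) (PMF.pure (Y ω + α • Z ω))
        (PMF.pure (Y ω - β • Z ω)))) :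
    Solvable World.input S K (t + 1 + 2 + m * n * 2 + m * n * 2 + maxStepTime m n s +
      m * n * 1 + maxStepTime m n s) fun ω D => ω.1.Rounds (Y ω) D := by
  refine solvable_maxStep (fr := fr) hK hY hZ (fun ω hω => ?_) fun S₁ hS₁ α hα => ?_
  · obtain ⟨h1, h2, h3, h4, -⟩ := hS ω hω
    exact ⟨h1, h2, h3, h4⟩
  refine solvable_update (f := fun ω => -Z ω)
    (fun i j => ((Cost.mem (.inr (hZ i j))).neg (.inr hK.zero))) fun K₁ hK₁ hnZ => ?_
  have hKK₁ : K ⊆ K₁ := (Set.subset_insert _ _).trans hK₁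
  refine solvable_maxStep (fr := fr) (hK.mono hKK₁) (hY.mono hKK₁) hnZ (fun ω hω => ?_)
    fun S₂ hS₂ β hβ => ?_
  · obtain ⟨h1, h2, h3, -, h5⟩ := hS ω (hS₁ hω)
    exact ⟨h1, h2, h3.neg, h5⟩
  have hKK₂ : K ⊆ insert β K₁ := hKK₁.trans (Set.subset_insert _ _)
  have hαK : α ∈ insert β K₁ := .inr (hK₁ (Set.mem_insert _ _))
  refine solvable_update (f := fun ω => Y ω + α ω • Z ω)
    (fun i j => (Cost.mem (hKK₂ (hY i j))).add
      ((Cost.mem hαK).mul (Cost.mem (hKK₂ (hZ i j))))) fun K₃ hK₃ hf₁ => ?_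
  refine solvable_update (f := fun ω => Y ω - β ω • Z ω)
    (fun i j => (Cost.mem (hK₃ (hKK₂ (hY i j)))).sub
      ((Cost.mem (hK₃ (Set.mem_insert _ _))).mul (Cost.mem (hK₃ (hKK₂ (hZ i j))))))
    fun K₄ hK₄ hf₂ => ?_
  have hβ₄ : β ∈ K₄ := hK₄ (hK₃ (Set.mem_insert _ _))
  refine Solvable.insert_cost (q := fun ω => β ω / (α ω + β ω))
    ((Cost.mem hβ₄).div ((Cost.mem (hK₄ (hK₃ hαK))).add (Cost.mem hβ₄))) ?_
  have hbasic : Basic (insert (fun ω => β ω / (α ω + β ω)) K₄) :=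
    hK.mono (((hKK₂.trans hK₃).trans hK₄).trans (Set.subset_insert _ _))
  have hm : ∀ ω ∈ S₂, ω.1.Move (Y ω) (PMF.mix (β ω / (α ω + β ω))
      (PMF.pure (Y ω + α ω • Z ω)) (PMF.pure (Y ω - β ω • Z ω))) := fun ω hω =>
    hmove ω (hS₁ (hS₂ hω)) _ _ (hα ω (hS₂ hω)) (hβ ω hω)
  have hnext : ∀ ω ∈ S₂, ∀ y', ω.1.Step (Y ω) y' →
      ω.1.Keeps y' y' ∧ ω.1.potential y' < p := by
    intro ω hω y' hs
    have := hs.potential_lt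
    have := hp ω (hS₁ (hS₂ hω))
    exact ⟨hs.keeps_self, by omega⟩
  refine Solvable.coin (Set.mem_insert _ _)
    (hrec S₂ _ _ hbasic ((hf₁.mono hK₄).mono (Set.subset_insert _ _)) fun ω hω => hnext ω hω _ ?_)
    (hrec S₂ _ _ hbasic (hf₂.mono (Set.subset_insert _ _)) fun ω hω => hnext ω hω _ ?_)
    fun ω hω D₁ D₂ h₁ h₂ => .of_mix (hm ω hω) ?_ h₁ h₂
  · have h1 := (hα ω (hS₂ hω)).1
    have h2 := (hβ ω hω).1
    exact (hm ω hω).mem_support_step (PMF.mem_support_mix_left (by positivity) (by simp))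
  · have h1 := (hα ω (hS₂ hω)).1
    have h2 := (hβ ω hω).1
    refine (hm ω hω).mem_support_step (PMF.mem_support_mix_right ?_ (by simp))
    rw [div_lt_one (by positivity)]
    linarith
  · intro heq
    have h1 := (hα ω (hS₂ hω)).1
    have h2 := (hβ ω hω).1
    -- Equal outcomes would force the direction to vanish.
    have h3 : (α ω + β ω) • Z ω = 0 := by
      have : α ω • Z ω + β ω • Z ω = (Y ω + α ω • Z ω) - (Y ω - β ω • Z ω) := by abel
      rw [add_smul, this, heq, sub_self]
    rcases smul_eq_zero.1 h3 with h | h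
    · linarith
    · exact (hS ω (hS₁ (hS₂ hω))).2.2.1.1 h

/-! ### One iteration and the recursion -/

/-- Two solutions have the same pattern if all comparisons have the same results. -/
theorem pattern_eq_of_comparisons {I I' : AdCell m n s} {y y' : Frac m n} (hy : I.Keeps y y)
    (hy' : I'.Keeps y' y') (h0 : ∀ i j, y i j ≤ 0 ↔ y' i j ≤ 0)
    (h1 : ∀ i j, 1 ≤ y i j ↔ 1 ≤ y' i j)
    (hv : ∀ v, I.bound v ≤ I.load y v ↔ I'.bound v ≤ I'.load y' v)
    (hc : ∀ j k, I.customer j = k ↔ I'.customer j = k) : I.pattern y = I'.pattern y' := by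
  simp only [pattern, Pattern.mk.injEq]
  refine ⟨funext fun j => ((hc j _).1 rfl).symm, ?_, ?_, ?_⟩
  · ext i j
    simp only [IsFrac, ← not_le, h0, h1]
  · ext j
    have := hv (.inr (.inl j))
    exact ⟨fun h => (hy'.2.1 j).antisymm (this.1 h.ge), fun h => (hy.2.1 j).antisymm (this.2 h.ge)⟩
  · ext k
    have := hv (.inr (.inr k))
    exact ⟨fun h => (hy'.2.2.1 k).antisymm (this.1 h.ge),
      fun h => (hy.2.2.1 k).antisymm (this.2 h.ge)⟩

/-- Compute the pattern of the current solution. -/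
theorem solvable_pattern (hK : Basic K) (hY : Known K Y)
    (hS : ∀ ω ∈ S, ω.1.Keeps (Y ω) (Y ω))
    (h : ∀ S' ⊆ S, (∀ ω ∈ S', ∀ ω' ∈ S', ω.1.pattern (Y ω) = ω'.1.pattern (Y ω') ∧
        ∀ i j, 1 ≤ Y ω i j ↔ 1 ≤ Y ω' i j) → Solvable World.input S' K t G) :
    Solvable World.input S K (t + (m * n + (m * n + ((m + (n + s)) + n * s))) +
      (m + (n + s)) * (2 * (m * n))) G := by
  let a : (Fin m × Fin n) ⊕ (Fin m × Fin n) ⊕ Row m n s ⊕ (Fin n × Fin s) → World m n s → ℝ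
    | .inl e => fun ω => Y ω e.1 e.2
    | .inr (.inl _) => fun _ => 1
    | .inr (.inr (.inl v)) => fun ω => ω.1.bound v
    | .inr (.inr (.inr _)) => fun _ => 1
  let b : (Fin m × Fin n) ⊕ (Fin m × Fin n) ⊕ Row m n s ⊕ (Fin n × Fin s) → World m n s → ℝ
    | .inl _ => fun _ => 0
    | .inr (.inl e) => fun ω => Y ω e.1 e.2
    | .inr (.inr (.inl v)) => fun ω => ω.1.load (Y ω) v
    | .inr (.inr (.inr jk)) => fun ω => World.input ω (.customer jk.1 jk.2)
  have key : Solvable World.input S (K ∪ Set.range fun v ω => ω.1.load (Y ω) v)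
      (t + Fintype.card ((Fin m × Fin n) ⊕ (Fin m × Fin n) ⊕ Row m n s ⊕ (Fin n × Fin s))) G := by
    refine Solvable.decide (a := a) (b := b) ?_ ?_ fun σ => ?_
    · rintro (e | e | v | jk)
      · exact .inl (hY e.1 e.2)
      · exact .inl hK.one
      · exact .inl (hK.bound_mem v)
      · exact .inl hK.one
    · rintro (e | e | v | jk)
      · exact .inl hK.zero
      · exact .inl (hY e.1 e.2)
      · exact .inr ⟨v, rfl⟩
      · exact .inl (hK.input _)
    · refine (h _ (fun ω hω => hω.1) fun ω hω ω' hω' => ?_).mono_known Set.subset_union_left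
      have hσ : ∀ x, a x ω ≤ b x ω ↔ a x ω' ≤ b x ω' := fun x => (hω.2 x).trans (hω'.2 x).symm
      -- The pattern does not tell variables rounded to `0` from those rounded to `1`; these
      -- comparisons do, as the final output requires.
      have h1 : ∀ i j, 1 ≤ Y ω i j ↔ 1 ≤ Y ω' i j := fun i j => hσ (.inr (.inl (i, j)))
      refine ⟨pattern_eq_of_comparisons (hS ω hω.1) (hS ω' hω'.1) (fun i j => hσ (.inl (i, j))) h1
        (fun v => hσ (.inr (.inr (.inl v)))) fun j k => ?_, h1⟩
      have hone : ∀ ω : World m n s, 1 ≤ World.input ω (.customer j k) ↔ ω.1.customer j = k := by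
        intro ω
        simp only [World.input, AdCell.input]
        split_ifs with hjk <;> simp [hjk]
      rw [← hone, ← hone]
      exact hσ (.inr (.inr (.inr (j, k))))
  have := Solvable.union_range (fun v => hY.cost_load hK v) key
  simpa [Row] using this

/-- Compute a solution of a system of homogeneous equations. -/
theorem solvable_solves (hK : Basic K) {F : Finset (Fin m × Fin n)} {C : Finset (Row m n s)}
    (hFC : C.card < F.card)
    (h : ∀ S' ⊆ S, ∀ K' ⊇ K, ∀ Z : World m n s → Frac m n, Known K' Z →
      (∀ ω ∈ S', ω.1.Solves F C (Z ω)) → Solvable World.input S' K' t G) :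
    Solvable World.input S K (t + (m + (n + s)) * (3 * ((m + (n + s)) * (m * n)) +
      4 * (m * n) + 2)) G := by
  have := Solvable.kernel (inp := World.input) (G := G) (S := S) (K := K) (t := t) C F
    (A := fun v e ω => ω.1.coef v e) hFC hK.zero hK.one hK.coef_mem fun S' hS' z hz => by
      refine h S' hS' _ Set.subset_union_left (fun ω i j => z (i, j) ω)
        (fun i j => .inr ⟨(i, j), rfl⟩) fun ω hω => ?_
      obtain ⟨h1, ⟨e, he⟩, h3⟩ := hz ω hω
      refine ⟨fun h0 => he ?_, fun e he => h1 e he, fun v hv => ?_⟩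
      · exact congrFun (congrFun h0 e.1) e.2
      · rw [load_eq_sum]
        exact h3 v hv
  refine this.mono_time ?_
  have hC : C.card ≤ m + (n + s) := by simpa using Finset.card_le_univ C
  simp only [Fintype.card_sum, Fintype.card_prod, Fintype.card_fin]
  gcongr

/-- A bound on the time of one iteration. -/
def moveTime (m n s : ℕ) : ℕ :=
  (3 + m * n * 5 + 2 * maxStepTime m n s) + (m * n * 1 + 1 + 2 * (m * n)) +
    (m + (n + s)) * (3 * ((m + (n + s)) * (m * n)) + 4 * (m * n) + 2) +
    (m * n + (m * n + ((m + (n + s)) + n * s))) + (m + (n + s)) * (2 * (m * n))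

/-- After the comparisons all worlds of a branch share one pattern. A plan chosen for a sample world
is a plan for all of them, and only the real numbers realizing it remain to be computed. -/
theorem Continues.succ {p : ℕ} (hrec : Continues m n s p t) :
    Continues m n s (p + 1) (t + moveTime m n s) := by
  intro S K Y hK hY hS
  suffices h : ∀ S' ⊆ S, (∀ ω ∈ S', ∀ ω' ∈ S', ω.1.pattern (Y ω) = ω'.1.pattern (Y ω') ∧
      ∀ i j, 1 ≤ Y ω i j ↔ 1 ≤ Y ω' i j) → Solvable World.input S' K
      ((t + (3 + m * n * 5 + 2 * maxStepTime m n s) + (m * n * 1 + 1 + 2 * (m * n))) +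
        (m + (n + s)) * (3 * ((m + (n + s)) * (m * n)) + 4 * (m * n) + 2))
      fun ω D => ω.1.Rounds (Y ω) D by
    refine (solvable_pattern hK hY (fun ω hω => (hS ω hω).1) h).mono_time (le_of_eq ?_)
    unfold moveTime
    ring
  intro S₁ hS₁ hpat
  refine .of_nonempty fun ω₀ hω₀ => ?_
  have hP : ∀ ω ∈ S₁, ω.1.pattern (Y ω) = ω₀.1.pattern (Y ω₀) := fun ω hω => (hpat ω hω ω₀ hω₀).1
  have hfr : ∀ ω ∈ S₁, IsFrac (Y ω) = IsFrac (Y ω₀) := fun ω hω => congrArg Pattern.frac (hP ω hω)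
  have hkeep : ∀ ω ∈ S₁, ω.1.Keeps (Y ω) (Y ω) := fun ω hω => (hS ω (hS₁ hω)).1
  have hpot : ∀ ω ∈ S₁, ω.1.potential (Y ω) < p + 1 := fun ω hω => (hS ω (hS₁ hω)).2
  by_cases hr : Rounded (Y ω₀)
  · classical
    -- The output is read off the sample world, and the comparisons with `1` make it correct for the
    -- whole branch.
    let X : Alloc m n := fun i j => decide (1 ≤ Y ω₀ i j)
    refine .output X fun ω hω => ?_
    have hYX : Y ω = X.toFrac := by
      ext i j
      have hb := (hkeep ω hω).1 i j
      have h1 := (hpat ω hω ω₀ hω₀).2 i j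
      have hnf : ¬ IsFrac (Y ω) i j := by
        rw [hfr ω hω]
        rintro ⟨g0, g1⟩
        rcases hr i j with h | h <;> linarith
      simp only [Alloc.toFrac, X, decide_eq_true_eq]
      split_ifs with hc
      · exact hb.2.antisymm (h1.2 hc)
      · exact (eq_of_not_isFrac (hkeep ω hω).1 hnf).resolve_right fun h => hc (h1.1 h.ge)
    rw [hYX]
    exact .done X
  obtain ⟨F, C, ⟨j₀, hplan⟩ | hplan | ⟨k₀, hplan⟩⟩ := ω₀.1.exists_plan (hkeep ω₀ hω₀) hr
  · refine solvable_solves hK hplan.card fun S₂ hS₂ K₂ hK₂ Z hZ hsol => ?_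
    refine (solvable_sign (t := t + (3 + m * n * 5 + 2 * maxStepTime m n s)) (.inr (.inl j₀))
      (hK.mono hK₂) hZ
      fun S₃ hS₃ K₃ hK₃ Z' hZ' hsign => ?_).mono_time (le_of_eq (by ring))
    have hsol' : ∀ ω ∈ S₃, ω.1.Solves F C (Z' ω) := fun ω hω => by
      rcases (hsign ω hω).1 with h | h
      · exact h ▸ hsol ω (hS₃ hω)
      · exact h ▸ (hsol ω (hS₃ hω)).neg
    have hS₃₁ : ∀ ω ∈ S₃, ω ∈ S₁ := fun ω hω => hS₂ (hS₃ hω)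
    have hplan' : ∀ ω ∈ S₃, (ω.1.pattern (Y ω)).CyclePlan F C j₀ := fun ω hω => by
      rw [hP ω (hS₃₁ ω hω)]
      exact hplan
    refine (solvable_deterministic hrec (fr := IsFrac (Y ω₀)) ((hK.mono hK₂).mono hK₃)
      ((hY.mono hK₂).mono hK₃) hZ' (fun ω hω => ?_) (fun ω hω => hpot ω (hS₃₁ ω hω))
      fun ω hω => ((hsol' ω hω).breakCycle (hplan' ω hω) (hsign ω hω).2).2).mono_time (by omega)
    exact ⟨hfr ω (hS₃₁ ω hω), hkeep ω (hS₃₁ ω hω), (hsol' ω hω).isDirection (hplan' ω hω).frac,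
      ((hsol' ω hω).breakCycle (hplan' ω hω) (hsign ω hω).2).1⟩
  · refine solvable_solves hK hplan.card fun S₂ hS₂ K₂ hK₂ Z hZ hsol => ?_
    have hplan' : ∀ ω ∈ S₂, (ω.1.pattern (Y ω)).RandPlan F C := fun ω hω => by
      rw [hP ω (hS₂ hω)]
      exact hplan
    refine (solvable_randMove hrec (fr := IsFrac (Y ω₀)) (hK.mono hK₂) (hY.mono hK₂) hZ
      (fun ω hω => ?_) (fun ω hω => hpot ω (hS₂ hω))
      fun ω hω α β => (hsol ω hω).randMove (hplan' ω hω)).mono_time (by omega)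
    exact ⟨hfr ω (hS₂ hω), hkeep ω (hS₂ hω), (hsol ω hω).isDirection (hplan' ω hω).frac,
      (hsol ω hω).allows_of_randPlan (hkeep ω (hS₂ hω)) (hplan' ω hω),
      (hsol ω hω).neg.allows_of_randPlan (hkeep ω (hS₂ hω)) (hplan' ω hω)⟩
  · refine solvable_solves hK hplan.card fun S₂ hS₂ K₂ hK₂ Z hZ hsol => ?_
    refine (solvable_sign (t := t + (3 + m * n * 5 + 2 * maxStepTime m n s)) (.inr (.inr k₀))
      (hK.mono hK₂) hZ
      fun S₃ hS₃ K₃ hK₃ Z' hZ' hsign => ?_).mono_time (le_of_eq (by ring))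
    have hsol' : ∀ ω ∈ S₃, ω.1.Solves F C (Z' ω) := fun ω hω => by
      rcases (hsign ω hω).1 with h | h
      · exact h ▸ hsol ω (hS₃ hω)
      · exact h ▸ (hsol ω (hS₃ hω)).neg
    have hS₃₁ : ∀ ω ∈ S₃, ω ∈ S₁ := fun ω hω => hS₂ (hS₃ hω)
    have hplan' : ∀ ω ∈ S₃, (ω.1.pattern (Y ω)).LowerPlan F C k₀ := fun ω hω => by
      rw [hP ω (hS₃₁ ω hω)]
      exact hplan
    have hlow := fun ω hω => (hsol' ω hω).lowerTight (hkeep ω (hS₃₁ ω hω)) (hplan' ω hω)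
      (hsign ω hω).2
    refine (solvable_deterministic hrec (fr := IsFrac (Y ω₀)) ((hK.mono hK₂).mono hK₃)
      ((hY.mono hK₂).mono hK₃) hZ' (fun ω hω => ?_) (fun ω hω => hpot ω (hS₃₁ ω hω))
      fun ω hω => (hlow ω hω).2).mono_time (by omega)
    exact ⟨hfr ω (hS₃₁ ω hω), hkeep ω (hS₃₁ ω hω), (hsol' ω hω).isDirection (hplan' ω hω).frac,
      (hlow ω hω).1⟩

/-- Each iteration lowers the potential by at least one, so the bound `p` counts the remaining
iterations. At `p = 0` no world is left. -/
theorem continues (p : ℕ) : Continues m n s p (p * moveTime m n s) := by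
  induction p with
  | zero =>
    intro S K Y _ _ hS
    exact .output (fun _ _ => false) fun ω hω => absurd (hS ω hω).2 (Nat.not_lt_zero _)
  | succ p ih =>
    rw [Nat.succ_mul]
    exact ih.succ

/-- A bound on the number of moves. -/
def maxMoves (m n s : ℕ) : ℕ := (m * n + 1) * ((n + 1) * (m + n + s + 1))

/-- The rounding as a computation tree. -/
theorem exists_compTree (m n s : ℕ) :
    ∃ T : CompTree (InputReg m n s) (Alloc m n), T.time ≤ maxMoves m n s * moveTime m n s + 2 ∧
      ∀ (I : AdCell m n s) (y : Frac m n), I.Keeps y y → I.Rounds y (T.run (I.input y)) := by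
  have h : Solvable World.input {ω : World m n s | ω.1.Keeps ω.2 ω.2} ∅
      (maxMoves m n s * moveTime m n s + 1 + 1) fun ω D => ω.1.Rounds ω.2 D := by
    refine .union_inputs (.insert_one ?_)
    -- The only constant provided by an instruction is `1`; here `0` is obtained as `1 - 1`. This
    -- accounts for the two extra units of time.
    refine Solvable.insert_cost (q := fun _ => 0) (c := 1) ?_ ?_
    · have h1 : Cost (insert (fun _ => 1) (∅ ∪ Set.range fun r (ω : World m n s) => ω.input r))
          (fun _ => 1) 0 := Cost.mem (Set.mem_insert _ _)
      simpa only [sub_self] using h1.sub h1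
    · refine continues (maxMoves m n s) _ _ (fun ω => ω.2) ⟨by simp, by simp, fun r => ?_⟩
        (fun i j => ?_) fun ω hω => ⟨hω, ω.1.potential_lt ω.2⟩
      · exact .inr (.inr (.inr ⟨r, rfl⟩))
      · exact .inr (.inr (.inr ⟨.sol i j, rfl⟩))
  obtain ⟨T, hT, hG⟩ := h (fun _ _ => 0) 0 (by simp)
  exact ⟨T, hT, fun I y hy => hG (I, y) hy⟩

/-- The tree yields some complete execution from `y`. Since `y` is not rounded, this execution
cannot be finished and must begin with a move. -/
theorem exists_move (I : AdCell m n s) {y : Frac m n} (hy : I.Keeps y y) (hr : ¬ Rounded y) :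
    ∃ μ, I.Move y μ := by
  obtain ⟨D, hD⟩ : ∃ D, I.Rounds y D :=
    let ⟨T, _, hT⟩ := exists_compTree m n s
    ⟨_, hT I y hy⟩
  cases hD with
  | done X =>
    refine absurd (fun i j => ?_) hr
    by_cases hX : X i j <;> simp [Alloc.toFrac, hX]
  | move _ μ K hμ _ => exact ⟨μ, hμ⟩

end AdCell

namespace AdCell

/-! ### Polynomial bounds -/

theorem mul_le_size_sq (m n s : ℕ) : m * n ≤ (m + n + s + 1) ^ 2 := by
  rw [sq]
  exact Nat.mul_le_mul (by omega) (by omega)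

theorem maxMoves_le (m n s : ℕ) : maxMoves m n s ≤ 2 * (m + n + s + 1) ^ 4 := by
  have h1 := mul_le_size_sq m n s
  have hn : n + 1 ≤ m + n + s + 1 := by omega
  unfold maxMoves
  generalize m + n + s + 1 = M at *
  have hM : 1 ≤ M ^ 2 := Nat.one_le_pow _ _ (by omega)
  calc (m * n + 1) * ((n + 1) * M) ≤ (M ^ 2 + M ^ 2) * (M * M) := by gcongr
    _ = 2 * M ^ 4 := by ring

/-- Replacing every factor by a power of `M = m + n + s + 1` gives a polynomial of degree four whose
coefficients sum to 93, so 1000 is generous. -/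
theorem moveTime_le (m n s : ℕ) : moveTime m n s ≤ 1000 * (m + n + s + 1) ^ 4 := by
  have h1 := mul_le_size_sq m n s
  have h2 : n * s ≤ (m + n + s + 1) ^ 2 := by
    rw [sq]
    exact Nat.mul_le_mul (by omega) (by omega)
  have h3 : m + (n + s) ≤ m + n + s + 1 := by omega
  have hM : 1 ≤ m + n + s + 1 := by omega
  unfold moveTime maxStepTime numIneq
  generalize m + n + s + 1 = M at *
  generalize m * n = a at *
  generalize n * s = b at *
  generalize m + (n + s) = c at *
  have p1 : M ≤ M ^ 4 := by simpa using Nat.pow_le_pow_right hM (show 1 ≤ 4 by norm_num)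
  have p2 : M ^ 2 ≤ M ^ 4 := Nat.pow_le_pow_right hM (by norm_num)
  have p3 : M ^ 3 ≤ M ^ 4 := Nat.pow_le_pow_right hM (by norm_num)
  calc _ ≤ (3 + M ^ 2 * 5 + 2 * ((M ^ 2 + (M ^ 2 + M)) * (M ^ 2 + (M ^ 2 + M)) +
        2 * (M ^ 2 + (M ^ 2 + M)) + 2 * ((M ^ 2 + (M ^ 2 + M)) * (2 * M ^ 2 + 1)))) +
        (M ^ 2 * 1 + 1 + 2 * M ^ 2) + M * (3 * (M * M ^ 2) + 4 * M ^ 2 + 2) +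
        (M ^ 2 + (M ^ 2 + (M + M ^ 2))) + M * (2 * M ^ 2) := by gcongr
    _ = 4 + 27 * M ^ 4 + 22 * M ^ 3 + 29 * M ^ 2 + 11 * M := by ring
    _ ≤ 1000 * M ^ 4 := by omega

theorem poly_le {C d k : ℕ} (M : ℕ) (hM : 1 ≤ M) (hd : d ≤ C) (hk : k ≤ C) :
    k * M ^ d ≤ C * M ^ C :=
  Nat.mul_le_mul hk (Nat.pow_le_pow_right hM hd)

end AdCell

/-! ### Assembly of the main theorem -/

theorem mainTheorem4 :
    ∃ C : ℕ, ∀ m n s : ℕ,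
      -- every execution of the rounding, from any optimal solution of the linear program
      (∀ (I : AdCell m n s) (y : Frac m n), I.IsLPOptimal y →
        -- it stops after polynomially many iterations, and not before all variables are rounded
        (∀ (N : ℕ) (path : ℕ → Frac m n), path 0 = y →
          (∀ t < N, I.Step (path t) (path (t + 1))) → N ≤ C * (m + n + s + 1) ^ C) ∧
        (∀ y' : Frac m n, Relation.ReflTransGen I.Step y y' → ¬ AdCell.Rounded y' →
          ∃ μ, I.Move y' μ) ∧
        -- the allocation found
        (∀ D : PMF (Alloc m n), I.Rounds y D →
          (∀ X ∈ D.support, I.Feasible X) ∧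
          (4 - I.maxBidRatio) / 4 * I.lpOpt ≤ D.expect I.revenue ∧
          ((∀ i j, I.bid i j ≤ I.budget i) → 3 / 4 * I.lpOpt ≤ D.expect I.revenue) ∧
          (∀ ε : ℝ, (∀ i j, I.bid i j ≤ ε * I.budget i) →
            (4 - ε) / 4 * I.lpOpt ≤ D.expect I.revenue))) ∧
      -- the optimum of the linear program bounds the revenue of every feasible allocation
      (∀ (I : AdCell m n s) (X : Alloc m n), I.Feasible X → I.revenue X ≤ I.lpOpt) ∧
      -- bids above the budgets: round for the truncated bids
      (∀ (I : AdCell m n s) (y : Frac m n), I.truncate.IsLPOptimal y →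
        ∀ D : PMF (Alloc m n), I.truncate.Rounds y D →
          (∀ X ∈ D.support, I.Feasible X) ∧
          3 / 4 * I.truncate.lpOpt ≤ D.expect I.revenue ∧
          (∀ X, I.Feasible X → 3 / 4 * I.revenue X ≤ D.expect I.revenue)) ∧
      -- the rounding runs in polynomial time
      (∃ T : CompTree (InputReg m n s) (Alloc m n), T.time ≤ C * (m + n + s + 1) ^ C ∧
        ∀ (I : AdCell m n s) (y : Frac m n), I.IsLPOptimal y →
          I.Rounds y (T.run (I.input y))) := by
  -- The constant is both factor and exponent. The running time needs a factor 2002 and an exponent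
  -- 8, which also cover the number of moves.
  refine ⟨3000, fun m n s => ⟨fun I y hy => ⟨?_, ?_, fun D hD => ⟨?_, ?_, ?_, ?_⟩⟩, ?_, ?_, ?_⟩⟩
  · intro N path h0 hsteps
    calc N ≤ I.potential y := I.length_le_of_steps N path h0 hsteps
      _ ≤ AdCell.maxMoves m n s := (I.potential_lt y).le
      _ ≤ 2 * (m + n + s + 1) ^ 4 := AdCell.maxMoves_le m n s
      _ ≤ _ := AdCell.poly_le _ (by omega) (by norm_num) (by norm_num)
  · exact fun y' hy' hr => I.exists_move (I.keeps_of_reachable hy.1.keeps hy') hr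
  · exact hD.feasible hy.1.keeps
  · exact hD.expect_revenue hy I.bid_le_maxBidRatio_mul
  · intro hb
    have := hD.expect_revenue hy (ε := 1) (by simpa using hb)
    norm_num at this ⊢
    exact this
  · exact fun ε hε => hD.expect_revenue hy hε
  · exact fun I X hX => AdCell.revenue_le_lpOpt hX
  · intro I y hy D hD
    have hrev : I.truncate.revenue = I.revenue := funext I.truncate_revenue
    have h34 : 3 / 4 * I.truncate.lpOpt ≤ D.expect I.revenue := by
      have := hD.expect_revenue hy (ε := 1) fun i j => by
        rw [one_mul]
        exact min_le_right _ _
      rw [hrev] at this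
      norm_num at this ⊢
      exact this
    refine ⟨fun X hX => hD.feasible hy.1.keeps X hX, h34, fun X hX => le_trans ?_ h34⟩
    rw [← hrev]
    -- Feasibility does not involve the bids, so `hX` serves for the truncated instance as it
    -- stands.
    exact mul_le_mul_of_nonneg_left (AdCell.revenue_le_lpOpt (I := I.truncate) hX) (by norm_num)
  · obtain ⟨T, hT, h⟩ := AdCell.exists_compTree m n s
    refine ⟨T, hT.trans ?_, fun I y hy => h I y hy.1.keeps⟩
    calc AdCell.maxMoves m n s * AdCell.moveTime m n s + 2
        ≤ 2 * (m + n + s + 1) ^ 4 * (1000 * (m + n + s + 1) ^ 4) + 2 * (m + n + s + 1) ^ 8 :=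
          add_le_add (Nat.mul_le_mul (AdCell.maxMoves_le m n s) (AdCell.moveTime_le m n s))
            (Nat.le_mul_of_pos_right 2 (by positivity))
      _ = 2002 * (m + n + s + 1) ^ 8 := by ring
      _ ≤ _ := AdCell.poly_le _ (by omega) (by norm_num) (by norm_num)
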